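/- Let $\theta>0$. For Schwartz functions $f,g\in\mathcal S=\mathcal S(\mathbb R^2)$ (coordinates $x=(x_0,x_1)$, $x_0$ being time) let $$(f\star g)(x)=\frac1{(\pi\theta)^2}\int_{\mathbb R^2}\!\int_{\mathbb R^2} f(x+y)\,g(x+z)\,e^{-2i\,y\cdot\Theta^{-1}z}\,dy\,dz,\qquad \Theta=\theta\begin{pmatrix}0&1\\-1&0\end{pmatrix},$$ be the Moyal product. It extends by duality to products $a\star b$, $b\star a$ of $a\in\mathcal S'$ and $b\in\mathcal S$: $\langle a\star b,g\rangle=\langle a,b\star g\rangle$, $\langle b\star a,g\rangle=\langle a,g\star b\rangle$. Let $\mathcal M=\{a\in\mathcal S' : a\star b\in\mathcal S \text{ and } b\star a\in\mathcal S\text{ for all } b\in\mathcal S\}$ be the multiplier algebra, with product $\langle a\star c,b\rangle=\langle a,c\star b\rangle$ and with complex conjugation as involution. Put $z=(x_0+ix_1)/\sqrt2$, $f_{00}=2e^{-\frac2\theta\bar z z}$ and $f_{mn}=(\theta^{m+n}m!\,n!)^{-1/2}\,\bar z^{\star m}\star f_{00}\star z^{\star n}$, and for $a\in\mathcal S'$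 write $a_{mn}=\frac1{2\pi\theta}\int \overline{f_{mn}}\,a$ (so that $a=\sum a_{mn}f_{mn}$). The coherent state with parameter $\kappa\in\mathbb C$ is $$\omega_\kappa(a)=2\pi\theta\sum_{m,n}\overline{\varphi_m}\,a_{mn}\,\varphi_n,\qquad \varphi_m=\frac1{\sqrt{2\pi\theta}}\,e^{-\frac{|\kappa|^2}{2\theta}}\frac{\kappa^m}{\sqrt{m!\,\theta^m}}.$$ There is a largest $*$-subalgebra $\widetilde{\mathbb A}$ of $\mathcal M$ on which all coherent states are finite (i.e. the double series converges absolutely for all $\kappa\in\mathbb C$ and all $a\in\widetilde{\mathbb A}$). On Schwartz spinors $\phi\in\mathcal S\otimes\mathbb C^2$ let $\pi(a)\phi=(a\star\phi_1,a\star\phi_2)$, $D=-i\,\partial_\mu\otimes\gamma^\mu$ ($\mu=0,1$) with $\gamma^0=\begin{pmatrix}0&i\\i&0\end{pmatrix}$, $\gamma^1=\begin{pmatrix}0&i\\-i&0\end{pmatrix}$, and $\mathcal J=i\gamma^0$. Let $\mathcal C$ be the cone of all $a=a^*\in\widetilde{\mathbb A}$ with $\langle\phi,\mathcal J[D,\pi(a)]\phi\rangle_{L^2\otimes\mathbb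 C^2}\le0$ for all $\phi\in\mathcal S\otimes\mathbb C^2$, and write $\omega\preceq\eta$ if $\omega(a)\le\eta(a)$ for all $a\in\mathcal C$. Then, for all $\kappa_1,\kappa_2\in\mathbb C$, with $\Delta\kappa=\kappa_2-\kappa_1$ and $\lambda=\frac{1+i}{\sqrt2}$, the relation $\omega_{\kappa_1}\preceq\omega_{\kappa_2}$ holds if and only if $\Delta\kappa=\mu\lambda+\nu\bar\lambda$ for some real $\mu,\nu\ge0$; equivalently, if and only if $\Delta\kappa=0$ or $\arg\Delta\kappa\in[-\frac\pi4,\frac\pi4]$. -/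

import Mathlib

open scoped SchwartzMap ComplexConjugate

namespace Moyal
noncomputable section
open MeasureTheory SchwartzMap LineDeriv
open scoped ContDiff

theorem iteratedDeriv_cexp (c : ℂ) (n : ℕ) :
    iteratedDeriv n (fun t : ℝ => Complex.exp (c * t)) = fun t : ℝ => c ^ n * Complex.exp (c * t) := by
  induction n with
  | zero => simp
  | succ n ih =>
    rw [iteratedDeriv_succ, ih]
    funext t
    have h1 : HasDerivAt (fun t : ℝ => c * (t : ℂ)) c t := by
      simpa using (Complex.ofRealCLM.hasDerivAt (x := t)).const_mul c
    have h2 := (h1.cexp).const_mul (c ^ n)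
    rw [h2.deriv]
    ring

theorem norm_iteratedFDeriv_cexp_le {E : Type*} [NormedAddCommGroup E] [NormedSpace ℝ E]
    {q : E → ℝ} (hq : q.HasTemperateGrowth) (c : ℂ) (n : ℕ) :
    ∃ (k : ℕ) (C : ℝ), 0 ≤ C ∧ ∀ x, ‖iteratedFDeriv ℝ n (fun x => Complex.exp (c * q x)) x‖ ≤
      C * Real.exp (c.re * q x) * (1 + ‖x‖) ^ k := by
  obtain ⟨l, C, hC, h⟩ := hq.norm_iteratedFDeriv_le_uniform n
  refine ⟨l * n, n.factorial * (1 + ‖c‖) ^ n * (C + 1) ^ n, by positivity, fun x => ?_⟩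
  have hg : ContDiff ℝ ∞ (fun t : ℝ => Complex.exp (c * t)) := by
    have h2 : ContDiff ℝ ∞ (fun t : ℝ => (t : ℂ)) := Complex.ofRealCLM.contDiff
    fun_prop
  have := norm_iteratedFDeriv_comp_le (g := fun t : ℝ => Complex.exp (c * t)) (f := q)
    (n := n) (N := ∞) hg hq.1 (mod_cast le_top) x
    (C := (1 + ‖c‖) ^ n * Real.exp (c.re * q x)) (D := (C + 1) * (1 + ‖x‖) ^ l) ?_ ?_
  · refine this.trans (le_of_eq ?_)
    rw [mul_pow, ← pow_mul]; ring
  · intro i hi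
    rw [norm_iteratedFDeriv_eq_norm_iteratedDeriv, iteratedDeriv_cexp, norm_mul, norm_pow,
      Complex.norm_exp]
    have : (c * (q x : ℂ)).re = c.re * q x := by simp
    rw [this]
    gcongr
    calc ‖c‖ ^ i ≤ (1 + ‖c‖) ^ i := by gcongr; linarith
      _ ≤ (1 + ‖c‖) ^ n := by gcongr; linarith [norm_nonneg c]
  · intro i hi1 hi
    refine (h i hi x).trans ?_
    have h1 : (1 : ℝ) ≤ (1 + ‖x‖) ^ l := one_le_pow₀ (by linarith [norm_nonneg x])
    have h2 : 1 ≤ (C + 1) * (1 + ‖x‖) ^ l := by nlinarith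
    refine le_trans ?_ (le_self_pow₀ h2 (by omega))
    gcongr; linarith

/-- `x ↦ exp (c q(x))` has temperate growth when `c` is imaginary and `q` has temperate growth. -/
theorem hasTemperateGrowth_cexp {E : Type*} [NormedAddCommGroup E] [NormedSpace ℝ E]
    {q : E → ℝ} (hq : q.HasTemperateGrowth) (c : ℂ) (hc : c.re = 0) :
    (fun x => Complex.exp (c * q x)).HasTemperateGrowth := by
  refine ⟨?_, fun n => ?_⟩
  · have := hq.1
    have h2 : ContDiff ℝ ∞ (fun x => (q x : ℂ)) := Complex.ofRealCLM.contDiff.comp this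
    fun_prop
  · obtain ⟨k, C, hC, h⟩ := norm_iteratedFDeriv_cexp_le hq c n
    exact ⟨k, C, fun x => by simpa [hc] using h x⟩

theorem pow_mul_exp_bound {c : ℝ} (hc : 0 < c) (m : ℕ) :
    ∃ C : ℝ, ∀ r : ℝ, 0 ≤ r → (1 + r) ^ m * Real.exp (-c * r ^ 2) ≤ C := by
  refine ⟨m.factorial / c ^ m * Real.exp (2 * c), fun r hr => ?_⟩
  have h2 : (c * (1 + r)) ^ m / m.factorial ≤ Real.exp (c * (1 + r)) :=
    Real.pow_div_factorial_le_exp _ (by positivity) m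
  have h3 : (1 + r) ^ m ≤ m.factorial / c ^ m * Real.exp (c * (1 + r)) := by
    rw [mul_pow, div_le_iff₀ (by positivity)] at h2
    rw [div_mul_eq_mul_div, le_div_iff₀ (by positivity)]
    linarith
  calc (1 + r) ^ m * Real.exp (-c * r ^ 2)
      ≤ (m.factorial / c ^ m * Real.exp (c * (1 + r))) * Real.exp (-c * r ^ 2) := by gcongr
    _ = m.factorial / c ^ m * Real.exp (c * (1 + r) + -c * r ^ 2) := by rw [mul_assoc, Real.exp_add]
    _ ≤ _ := by
      refine mul_le_mul_of_nonneg_left (Real.exp_le_exp.mpr ?_) (by positivity)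
      nlinarith [mul_nonneg hc.le (sq_nonneg (2 * r - 1))]

/-- The Gaussian `x ↦ exp (-c |x|²)`, `c > 0`, as a Schwartz function. -/
def gaussianSchwartz {E : Type*} [NormedAddCommGroup E] [InnerProductSpace ℝ E]
    (c : ℝ) (hc : 0 < c) : 𝓢(E, ℂ) where
  toFun x := Complex.exp (((-c : ℝ) : ℂ) * ((‖x‖ ^ 2 : ℝ) : ℂ))
  smooth' := by
    have h2 : ContDiff ℝ ∞ (fun x : E => ((‖x‖ ^ 2 : ℝ) : ℂ)) :=
      Complex.ofRealCLM.contDiff.comp (contDiff_norm_sq ℝ)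
    fun_prop
  decay' k n := by
    obtain ⟨l, C, hC, h⟩ := norm_iteratedFDeriv_cexp_le
      (Function.hasTemperateGrowth_norm_sq (H := E)) ((-c : ℝ) : ℂ) n
    obtain ⟨B, hB⟩ := pow_mul_exp_bound hc (k + l)
    refine ⟨C * B, fun x => ?_⟩
    calc _ ≤ (1 + ‖x‖) ^ k * (C * Real.exp (-c * ‖x‖ ^ 2) * (1 + ‖x‖) ^ l) := by
          gcongr
          · linarith
          · simpa using h x
      _ = C * ((1 + ‖x‖) ^ (k + l) * Real.exp (-c * ‖x‖ ^ 2)) := by rw [pow_add]; ring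
      _ ≤ C * B := by gcongr; exact hB _ (norm_nonneg x)


/-- The tensor product `f ⊗ g` of two Schwartz functions, as a Schwartz function. -/
def tensor {E F : Type*} [NormedAddCommGroup E] [InnerProductSpace ℝ E]
    [NormedAddCommGroup F] [InnerProductSpace ℝ F] (f : 𝓢(E, ℂ)) (g : 𝓢(F, ℂ)) :
    𝓢(WithLp 2 (E × F), ℂ) where
  toFun w := f (WithLp.fstL 2 ℝ E F w) * g (WithLp.sndL 2 ℝ E F w)
  smooth' := ((f.smooth ⊤).comp (WithLp.fstL 2 ℝ E F).contDiff).mul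
    ((g.smooth ⊤).comp (WithLp.sndL 2 ℝ E F).contDiff)
  decay' k n := by
    set L₁ := WithLp.fstL 2 ℝ E F
    set L₂ := WithLp.sndL 2 ℝ E F
    set A := 2 ^ k * ((Finset.Iic (k, n)).sup (schwartzSeminormFamily ℝ E ℂ)) f
    set B := 2 ^ k * ((Finset.Iic (k, n)).sup (schwartzSeminormFamily ℝ F ℂ)) g
    have hA : 0 ≤ A := by positivity
    have hB : 0 ≤ B := by positivity
    refine ⟨∑ i ∈ Finset.range (n + 1), (n.choose i : ℝ) *
      ((1 + ‖L₁‖) ^ n * A) * ((1 + ‖L₂‖) ^ n * B), fun w => ?_⟩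
    have hmul := norm_iteratedFDeriv_mul_le (𝕜 := ℝ) (N := ∞) (f := f ∘ L₁) (g := g ∘ L₂)
      ((f.smooth ⊤).comp L₁.contDiff) ((g.smooth ⊤).comp L₂.contDiff) w (n := n)
      (mod_cast le_top)
    have hw : ‖w‖ ^ k ≤ (1 + ‖L₁ w‖) ^ k * (1 + ‖L₂ w‖) ^ k := by
      rw [← mul_pow]
      have h1 : ‖w‖ ^ 2 = ‖L₁ w‖ ^ 2 + ‖L₂ w‖ ^ 2 := WithLp.prod_norm_sq_eq_of_L2 w
      have : ‖w‖ ≤ (1 + ‖L₁ w‖) * (1 + ‖L₂ w‖) := by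
        have := norm_nonneg (L₁ w)
        have := norm_nonneg (L₂ w)
        have h3 := mul_nonneg (norm_nonneg (L₁ w)) (norm_nonneg (L₂ w))
        refine abs_le_of_sq_le_sq' ?_ (by positivity) |>.2
        rw [h1]; nlinarith
      gcongr
    have hf (i) (hi : i ≤ n) : (1 + ‖L₁ w‖) ^ k * ‖iteratedFDeriv ℝ i (f ∘ L₁) w‖ ≤
        (1 + ‖L₁‖) ^ n * A := by
      have h1 : ‖iteratedFDeriv ℝ i (f ∘ L₁) w‖ ≤ ‖iteratedFDeriv ℝ i f (L₁ w)‖ * ‖L₁‖ ^ i := by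
        rw [L₁.iteratedFDeriv_comp_right (f.smooth ⊤) w (mod_cast le_top)]
        simpa using ContinuousMultilinearMap.norm_compContinuousLinearMap_le
          (iteratedFDeriv ℝ i f (L₁ w)) (fun _ => L₁)
      have h2 : ‖L₁‖ ^ i ≤ (1 + ‖L₁‖) ^ n :=
        (pow_le_pow_left₀ (norm_nonneg L₁) (le_add_of_nonneg_left zero_le_one) i).trans
          (pow_le_pow_right₀ (le_add_of_nonneg_right (norm_nonneg L₁)) hi)
      have h3 := one_add_le_sup_seminorm_apply (𝕜 := ℝ) (m := (k, n)) le_rfl hi f (L₁ w)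
      calc _ ≤ (1 + ‖L₁ w‖) ^ k * (‖iteratedFDeriv ℝ i f (L₁ w)‖ * (1 + ‖L₁‖) ^ n) := by
            gcongr; exact h1.trans (by gcongr)
        _ = (1 + ‖L₁‖) ^ n * ((1 + ‖L₁ w‖) ^ k * ‖iteratedFDeriv ℝ i f (L₁ w)‖) := by ring
        _ ≤ _ := by gcongr; exact h3
    have hg (i) (hi : i ≤ n) : (1 + ‖L₂ w‖) ^ k * ‖iteratedFDeriv ℝ i (g ∘ L₂) w‖ ≤
        (1 + ‖L₂‖) ^ n * B := by
      have h1 : ‖iteratedFDeriv ℝ i (g ∘ L₂) w‖ ≤ ‖iteratedFDeriv ℝ i g (L₂ w)‖ * ‖L₂‖ ^ i := by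
        rw [L₂.iteratedFDeriv_comp_right (g.smooth ⊤) w (mod_cast le_top)]
        simpa using ContinuousMultilinearMap.norm_compContinuousLinearMap_le
          (iteratedFDeriv ℝ i g (L₂ w)) (fun _ => L₂)
      have h2 : ‖L₂‖ ^ i ≤ (1 + ‖L₂‖) ^ n :=
        (pow_le_pow_left₀ (norm_nonneg L₂) (le_add_of_nonneg_left zero_le_one) i).trans
          (pow_le_pow_right₀ (le_add_of_nonneg_right (norm_nonneg L₂)) hi)
      have h3 := one_add_le_sup_seminorm_apply (𝕜 := ℝ) (m := (k, n)) le_rfl hi g (L₂ w)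
      calc _ ≤ (1 + ‖L₂ w‖) ^ k * (‖iteratedFDeriv ℝ i g (L₂ w)‖ * (1 + ‖L₂‖) ^ n) := by
            gcongr; exact h1.trans (by gcongr)
        _ = (1 + ‖L₂‖) ^ n * ((1 + ‖L₂ w‖) ^ k * ‖iteratedFDeriv ℝ i g (L₂ w)‖) := by ring
        _ ≤ _ := by gcongr; exact h3
    calc _ ≤ ((1 + ‖L₁ w‖) ^ k * (1 + ‖L₂ w‖) ^ k) * ∑ i ∈ Finset.range (n + 1),
          (n.choose i : ℝ) * ‖iteratedFDeriv ℝ i (f ∘ L₁) w‖ *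
            ‖iteratedFDeriv ℝ (n - i) (g ∘ L₂) w‖ := by gcongr; exact hmul
      _ = ∑ i ∈ Finset.range (n + 1), (n.choose i : ℝ) *
          ((1 + ‖L₁ w‖) ^ k * ‖iteratedFDeriv ℝ i (f ∘ L₁) w‖) *
            ((1 + ‖L₂ w‖) ^ k * ‖iteratedFDeriv ℝ (n - i) (g ∘ L₂) w‖) := by
          rw [Finset.mul_sum]; refine Finset.sum_congr rfl fun i _ => by ring
      _ ≤ _ := by
          refine Finset.sum_le_sum fun i hi => ?_
          have h1 := hf i (by simpa [Nat.lt_succ_iff] using hi)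
          have h2 := hg (n - i) (by omega)
          exact mul_le_mul (mul_le_mul_of_nonneg_left h1 (by positivity)) h2 (by positivity)
            (by positivity)

/-- The plane `ℝ²`, with its Euclidean norm and Lebesgue measure; in the Lorentzian setting the
coordinate `0` is the time and `1` the space coordinate. -/
abbrev Plane : Type := EuclideanSpace ℝ (Fin 2)

/-- The noncommutativity matrix. -/
def Theta (θ : ℝ) : Matrix (Fin 2) (Fin 2) ℝ := θ • !![0, 1; -1, 0]

/-- The Moyal product of `f` and `g` at `x`. -/
def moyalFun (θ : ℝ) (f g : Plane → ℂ) (x : Plane) : ℂ :=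
  (((Real.pi * θ) ^ 2)⁻¹ : ℝ) * ∫ p : Plane × Plane, f (x + p.1) * g (x + p.2) *
    Complex.exp (-2 * Complex.I * ((∑ μ, ∑ ν, p.1 μ * (Theta θ)⁻¹ μ ν * p.2 ν : ℝ) : ℂ))

theorem Theta_inv (θ : ℝ) (hθ : θ ≠ 0) : (Theta θ)⁻¹ = θ⁻¹ • !![0, -1; 1, 0] := by
  apply Matrix.inv_eq_right_inv
  ext i j
  fin_cases i <;> fin_cases j <;> simp [Theta, Matrix.mul_apply, Fin.sum_univ_two, hθ]

/-- The linear map `x ↦ (x₁, -x₀)`. -/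
def rot : Plane →L[ℝ] Plane :=
  LinearMap.toContinuousLinearMap
    { toFun := fun x => !₂[x 1, -x 0]
      map_add' := fun x y => by
        ext i; fin_cases i <;> simp; ring
      map_smul' := fun c x => by
        ext i; fin_cases i <;> simp }

theorem rot_apply (x : Plane) : rot x = !₂[x 1, -x 0] := rfl

/-- The linear map `x ↦ (πθ)⁻¹ (rot x, -rot x)`. -/
def freq (θ : ℝ) : Plane →L[ℝ] WithLp 2 (Plane × Plane) :=
  (Real.pi * θ)⁻¹ • ((WithLp.prodContinuousLinearEquiv 2 ℝ Plane Plane).symm.toContinuousLinearMap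
    ∘L (rot.prod (-rot)))

theorem freq_apply (θ : ℝ) (x : Plane) :
    freq θ x = (Real.pi * θ)⁻¹ • WithLp.toLp 2 (rot x, -rot x) := rfl

theorem norm_le_freq (θ : ℝ) (hθ : θ ≠ 0) (x : Plane) :
    ‖x‖ ≤ |Real.pi * θ| * (1 + ‖freq θ x‖) ^ 1 := by
  have h0 : 0 < |Real.pi * θ| := abs_pos.2 (mul_ne_zero Real.pi_ne_zero hθ)
  have h1 : ‖x‖ = ‖rot x‖ := by
    simp [rot_apply, EuclideanSpace.norm_eq, Fin.sum_univ_two, add_comm]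
  have h2 : ‖rot x‖ ≤ ‖(WithLp.toLp 2 (rot x, -rot x) : WithLp 2 (Plane × Plane))‖ :=
    WithLp.norm_fst_le Plane (WithLp.toLp 2 (rot x, -rot x) : WithLp 2 (Plane × Plane))
  have h3 : ‖freq θ x‖ = |Real.pi * θ|⁻¹ *
      ‖(WithLp.toLp 2 (rot x, -rot x) : WithLp 2 (Plane × Plane))‖ := by
    rw [freq_apply, norm_smul, norm_inv, Real.norm_eq_abs]
  rw [h3, pow_one, mul_add, ← mul_assoc, mul_inv_cancel₀ h0.ne', one_mul, mul_one]
  linarith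

/-- The quadratic phase `p ↦ y ∧ z` for `p = (y, z)`. -/
def wedge (w : WithLp 2 (Plane × Plane)) : ℝ := w.fst 0 * w.snd 1 - w.fst 1 * w.snd 0

theorem wedge_hasTemperateGrowth : wedge.HasTemperateGrowth := by
  have h1 (i : Fin 2) : (fun w : WithLp 2 (Plane × Plane) => w.fst i).HasTemperateGrowth :=
    ((EuclideanSpace.proj i).comp (WithLp.fstL 2 ℝ Plane Plane)).hasTemperateGrowth
  have h2 (i : Fin 2) : (fun w : WithLp 2 (Plane × Plane) => w.snd i).HasTemperateGrowth :=
    ((EuclideanSpace.proj i).comp (WithLp.sndL 2 ℝ Plane Plane)).hasTemperateGrowth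
  exact ((h1 0).mul (h2 1)).sub ((h1 1).mul (h2 0))

open FourierTransform in
/-- The Moyal product of two Schwartz functions is a Schwartz function. -/
theorem exists_moyal (θ : ℝ) (f g : 𝓢(Plane, ℂ)) :
    ∃ h : 𝓢(Plane, ℂ), ∀ x, h x = moyalFun θ f g x := by
  rcases eq_or_ne θ 0 with rfl | hθ
  · exact ⟨0, fun x => by simp [moyalFun]⟩
  set c : ℂ := 2 * Complex.I * (θ⁻¹ : ℝ) with hc
  have hc0 : c.re = 0 := by simp [hc]
  have hT := hasTemperateGrowth_cexp wedge_hasTemperateGrowth c hc0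
  set Φ : 𝓢(WithLp 2 (Plane × Plane), ℂ) :=
    SchwartzMap.smulLeftCLM ℂ (fun w => Complex.exp (c * wedge w)) (tensor f g) with hΦ
  have : (volume : Measure (Plane × Plane)).IsAddLeftInvariant :=
    Measure.prod.instIsAddLeftInvariant
  refine ⟨((((Real.pi * θ) ^ 2)⁻¹ : ℝ) : ℂ) • SchwartzMap.compCLM ℂ (freq θ).hasTemperateGrowth
    ⟨1, |Real.pi * θ|, norm_le_freq θ hθ⟩ (𝓕 Φ), fun x => ?_⟩
  rw [smul_apply, smul_eq_mul, moyalFun]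
  congr 1
  rw [SchwartzMap.compCLM_apply, Function.comp_apply, SchwartzMap.fourier_coe,
    Real.fourier_eq',
    ← (WithLp.volume_preserving_toLp Plane Plane).integral_comp
      (MeasurableEquiv.toLp 2 (Plane × Plane)).measurableEmbedding,
    ← integral_add_left_eq_self _ ((x, x) : Plane × Plane)]
  congr 1
  funext p
  have hL : (WithLp.fstL 2 ℝ Plane Plane) (WithLp.toLp 2 ((x, x) + p)) = x + p.1 := rfl
  have hR : (WithLp.sndL 2 ℝ Plane Plane) (WithLp.toLp 2 ((x, x) + p)) = x + p.2 := rfl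
  have hten : (tensor f g) (WithLp.toLp 2 ((x, x) + p)) = f (x + p.1) * g (x + p.2) := rfl
  rw [hΦ, SchwartzMap.smulLeftCLM_apply_apply hT, hten, smul_eq_mul, smul_eq_mul, ← mul_assoc,
    ← Complex.exp_add, mul_comm (Complex.exp _)]
  congr 2
  have hπ : (Real.pi : ℂ) ≠ 0 := by exact_mod_cast Real.pi_ne_zero
  have hθ' : (θ : ℂ) ≠ 0 := by exact_mod_cast hθ
  rw [Theta_inv θ hθ, freq_apply, inner_smul_right]
  simp only [WithLp.prod_inner_apply, wedge, hc, Fin.sum_univ_two, PiLp.inner_apply, rot_apply]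
  simp
  field_simp
  ring

/-! ### The Moyal algebra and its multipliers -/

/-- The Moyal product `f ⋆ g` of two Schwartz functions. -/
def moyal (θ : ℝ) (f g : 𝓢(Plane, ℂ)) : 𝓢(Plane, ℂ) := (exists_moyal θ f g).choose

theorem moyal_apply (θ : ℝ) (f g : 𝓢(Plane, ℂ)) (x : Plane) :
    moyal θ f g x = moyalFun θ f g x := (exists_moyal θ f g).choose_spec x

/-- Complex conjugation of Schwartz functions. -/
def conjS : 𝓢(Plane, ℂ) →L[ℝ] 𝓢(Plane, ℂ) :=
  SchwartzMap.postcompCLM (Complex.conjCLE : ℂ ≃L[ℝ] ℂ).toContinuousLinearMap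

theorem conjS_apply (f : 𝓢(Plane, ℂ)) (x : Plane) : conjS f x = conj (f x) := rfl

/-- The involution `a ↦ a*` (complex conjugation) on tempered distributions:
`⟨a*, f⟩ = conj ⟨a, conj f⟩`. -/
def adj (a : 𝓢'(Plane, ℂ)) : 𝓢'(Plane, ℂ) :=
  ContinuousLinearMap.toPointwiseConvergenceCLM ℂ (RingHom.id ℂ) 𝓢(Plane, ℂ) ℂ
    { toFun := fun f => conj (a (conjS f))
      map_add' := fun f g => by simp
      map_smul' := fun c f => by
        have : conjS (c • f) = conj c • conjS f := by ext x; simp [conjS_apply]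
        simp [this]
      cont := Complex.continuous_conj.comp (a.continuous.comp conjS.continuous) }

theorem adj_apply (a : 𝓢'(Plane, ℂ)) (f : 𝓢(Plane, ℂ)) : adj a f = conj (a (conjS f)) := rfl

/-- `a ⋆ b = c`, for a tempered distribution `a` and Schwartz functions `b`, `c`; the product with a
distribution is defined by duality, `⟨a ⋆ b, g⟩ = ⟨a, b ⋆ g⟩`. -/
def IsLeftMul (θ : ℝ) (a : 𝓢'(Plane, ℂ)) (b c : 𝓢(Plane, ℂ)) : Prop :=
  ∀ g : 𝓢(Plane, ℂ), a (moyal θ b g) = ∫ x, c x * g x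

/-- `b ⋆ a = c`, for a tempered distribution `a` and Schwartz functions `b`, `c`; by duality,
`⟨b ⋆ a, g⟩ = ⟨a, g ⋆ b⟩`. -/
def IsRightMul (θ : ℝ) (a : 𝓢'(Plane, ℂ)) (b c : 𝓢(Plane, ℂ)) : Prop :=
  ∀ g : 𝓢(Plane, ℂ), a (moyal θ g b) = ∫ x, c x * g x

/-- The multiplier algebra: `a ⋆ b` and `b ⋆ a` are Schwartz functions for every Schwartz
function `b`. -/
def IsMultiplier (θ : ℝ) (a : 𝓢'(Plane, ℂ)) : Prop :=
  ∀ b : 𝓢(Plane, ℂ), (∃ c, IsLeftMul θ a b c) ∧ (∃ c, IsRightMul θ a b c)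

open Classical in
/-- The Schwartz function `L(a) b = a ⋆ b` (`0` if the distribution `a ⋆ b` is not a Schwartz
function, which does not happen for a multiplier `a`). -/
def leftMul (θ : ℝ) (a : 𝓢'(Plane, ℂ)) (b : 𝓢(Plane, ℂ)) : 𝓢(Plane, ℂ) :=
  if h : ∃ c, IsLeftMul θ a b c then h.choose else 0

open Classical in
/-- The Schwartz function `b ⋆ a` (with the same convention). -/
def rightMul (θ : ℝ) (a : 𝓢'(Plane, ℂ)) (b : 𝓢(Plane, ℂ)) : 𝓢(Plane, ℂ) :=
  if h : ∃ c, IsRightMul θ a b c then h.choose else 0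

open Classical in
/-- The product `a ⋆ c` of two multipliers, `⟨a ⋆ c, b⟩ = ⟨a, c ⋆ b⟩`. (For multipliers the right-hand
side is always a tempered distribution; the value in other cases is `0`.) -/
def mulDist (θ : ℝ) (a c : 𝓢'(Plane, ℂ)) : 𝓢'(Plane, ℂ) :=
  if h : ∃ d : 𝓢'(Plane, ℂ), ∀ b, d b = a (leftMul θ c b) then h.choose else 0

/-- `B` is a `*`-subalgebra of the multiplier algebra. -/
structure IsStarSubalgebra (θ : ℝ) (B : Submodule ℂ 𝓢'(Plane, ℂ)) : Prop where
  multiplier : ∀ a ∈ B, IsMultiplier θ a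
  adj_mem : ∀ a ∈ B, adj a ∈ B
  mul_mem : ∀ a ∈ B, ∀ c ∈ B, mulDist θ a c ∈ B

/-! ### Matrix basis, vector states, coherent states -/

/-- The coordinate function `z = (x₀ + i x₁) / √2`. -/
def zFun (x : Plane) : ℂ := ((x 0 : ℂ) + Complex.I * (x 1 : ℂ)) / (Real.sqrt 2 : ℂ)

/-- The coordinate function `z̄ = (x₀ - i x₁) / √2`. -/
def zbarFun (x : Plane) : ℂ := ((x 0 : ℂ) - Complex.I * (x 1 : ℂ)) / (Real.sqrt 2 : ℂ)

theorem coord_hasTemperateGrowth (i : Fin 2) :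
    (fun x : Plane => (x i : ℂ)).HasTemperateGrowth :=
  (Complex.ofRealCLM.comp (EuclideanSpace.proj i : Plane →L[ℝ] ℝ)).hasTemperateGrowth

theorem zFun_hasTemperateGrowth : zFun.HasTemperateGrowth := by
  have := ((coord_hasTemperateGrowth 0).add
    ((Function.HasTemperateGrowth.const Complex.I).mul (coord_hasTemperateGrowth 1))).mul
    (Function.HasTemperateGrowth.const ((Real.sqrt 2 : ℂ)⁻¹))
  exact this

theorem zbarFun_hasTemperateGrowth : zbarFun.HasTemperateGrowth := by
  have := ((coord_hasTemperateGrowth 0).sub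
    ((Function.HasTemperateGrowth.const Complex.I).mul (coord_hasTemperateGrowth 1))).mul
    (Function.HasTemperateGrowth.const ((Real.sqrt 2 : ℂ)⁻¹))
  exact this

/-- The function `z` as a tempered distribution. -/
def zDist : 𝓢'(Plane, ℂ) := zFun_hasTemperateGrowth.toTemperedDistribution

/-- The function `z̄` as a tempered distribution. -/
def zbarDist : 𝓢'(Plane, ℂ) := zbarFun_hasTemperateGrowth.toTemperedDistribution

/-- The Gaussian `f₀₀ = 2 exp (-(2/θ) z̄z) = 2 exp (-(x₀² + x₁²)/θ)`, for `θ > 0`. -/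
def f00 (θ : ℝ) : 𝓢(Plane, ℂ) :=
  if h : 0 < θ then (2 : ℂ) • gaussianSchwartz θ⁻¹ (inv_pos.2 h) else 0

theorem f00_apply {θ : ℝ} (hθ : 0 < θ) (x : Plane) :
    f00 θ x = 2 * Complex.exp (-(2 / θ) * (zbarFun x * zFun x)) := by
  have h2 : (Real.sqrt 2 : ℂ) * (Real.sqrt 2 : ℂ) = 2 := by
    norm_cast; exact Real.mul_self_sqrt (by norm_num)
  have h3 : zbarFun x * zFun x = ((‖x‖ ^ 2 : ℝ) : ℂ) / 2 := by
    rw [EuclideanSpace.norm_sq_eq, zbarFun, zFun, div_mul_div_comm, h2]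
    congr 1
    simp only [Fin.sum_univ_two, Real.norm_eq_abs, sq_abs]
    push_cast
    linear_combination (-(x 1 : ℂ) ^ 2) * Complex.I_sq
  rw [h3, f00, dif_pos hθ, smul_apply, smul_eq_mul]
  change 2 * Complex.exp (((-θ⁻¹ : ℝ) : ℂ) * ((‖x‖ ^ 2 : ℝ) : ℂ)) = _
  congr 2
  push_cast
  ring

/-- The matrix basis `f_{mn} = (θ^{m+n} m! n!)^{-1/2} z̄^{⋆m} ⋆ f₀₀ ⋆ z^{⋆n}`. -/
def matrixBasis (θ : ℝ) (m n : ℕ) : 𝓢(Plane, ℂ) :=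
  (((Real.sqrt (θ ^ (m + n) * m.factorial * n.factorial))⁻¹ : ℝ) : ℂ) •
    (rightMul θ zDist)^[n] ((leftMul θ zbarDist)^[m] (f00 θ))

/-- The coefficients of `a = ∑ a_{mn} f_{mn}`: since `‖f_{mn}‖² = 2πθ` in `L²`,
`a_{mn} = (2πθ)⁻¹ ∫ conj f_{mn} a`. -/
def coeff (θ : ℝ) (a : 𝓢'(Plane, ℂ)) (m n : ℕ) : ℂ :=
  (((2 * Real.pi * θ)⁻¹ : ℝ) : ℂ) * a (conjS (matrixBasis θ m n))

/-- The terms of the double series defining the vector state of `ψ`. -/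
def stateTerm (θ : ℝ) (ψ : ℕ → ℂ) (a : 𝓢'(Plane, ℂ)) (p : ℕ × ℕ) : ℂ :=
  conj (ψ p.1) * coeff θ a p.1 p.2 * ψ p.2

/-- The vector state `ω_ψ(a) = 2πθ ∑_{m,n} conj ψ_m a_{mn} ψ_n`. -/
def vectorState (θ : ℝ) (ψ : ℕ → ℂ) (a : 𝓢'(Plane, ℂ)) : ℂ :=
  ((2 * Real.pi * θ : ℝ) : ℂ) * ∑' p : ℕ × ℕ, stateTerm θ ψ a p

/-- The vector of the coherent state with parameter `κ`. -/
def coherentVec (θ : ℝ) (κ : ℂ) (m : ℕ) : ℂ :=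
  (((Real.sqrt (2 * Real.pi * θ))⁻¹ * Real.exp (-‖κ‖ ^ 2 / (2 * θ)) : ℝ) : ℂ) *
    (κ ^ m / (Real.sqrt (m.factorial * θ ^ m) : ℂ))

/-- `B` is a `*`-subalgebra of the multiplier algebra on which all coherent states are finite. -/
structure IsAdmissible (θ : ℝ) (B : Submodule ℂ 𝓢'(Plane, ℂ)) : Prop where
  isStarSubalgebra : IsStarSubalgebra θ B
  finite : ∀ a ∈ B, ∀ κ : ℂ, Summable (stateTerm θ (coherentVec θ κ) a)

/-! ### The Lorentzian Dirac operator and the causal order -/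

/-- Schwartz spinors: the elements of `𝓢 ⊗ ℂ²`, which is dense in `L² ⊗ ℂ²` and is preserved by the
Dirac operator and by left multiplication with multipliers. -/
abbrev Spinor : Type := Fin 2 → 𝓢(Plane, ℂ)

/-- The flat Dirac matrices, `γ⁰ = iσ¹` and `γ¹ = σ²`. -/
def gamma : Fin 2 → Matrix (Fin 2) (Fin 2) ℂ :=
  ![!![0, Complex.I; Complex.I, 0], !![0, Complex.I; -Complex.I, 0]]

/-- The Dirac operator `D = -i ∂_μ ⊗ γ^μ`. -/
def dirac (φ : Spinor) : Spinor := fun i =>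
  ∑ μ : Fin 2, ∑ j : Fin 2,
    (-Complex.I * gamma μ i j) • ∂_{(EuclideanSpace.single μ 1 : Plane)} (φ j)

/-- The fundamental symmetry `𝒥 = iγ⁰`. -/
def fundSymm (φ : Spinor) : Spinor := fun i => ∑ j : Fin 2, (Complex.I * gamma 0 i j) • φ j

/-- The representation `π(a) = L(a) ⊗ 1`. -/
def rep (θ : ℝ) (a : 𝓢'(Plane, ℂ)) (φ : Spinor) : Spinor := fun i => leftMul θ a (φ i)

/-- The inner product of `L² ⊗ ℂ²`. -/
def spinorInner (ψ φ : Spinor) : ℂ := ∑ i : Fin 2, ∫ x, conj (ψ i x) * φ i x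

/-- The causal cone of `A`: the Hermitian `a ∈ A` with `⟨φ, 𝒥[D, π(a)]φ⟩ ≤ 0` for all `φ` (the
left-hand side is a real number for Hermitian `a`). -/
def causalCone (θ : ℝ) (A : Submodule ℂ 𝓢'(Plane, ℂ)) : Set 𝓢'(Plane, ℂ) :=
  {a | a ∈ A ∧ adj a = a ∧ ∀ φ : Spinor,
    (spinorInner φ (fundSymm (dirac (rep θ a φ) - rep θ a (dirac φ)))).re ≤ 0}

/-- The causal relation `s ⪯ t` of functionals: `s(a) ≤ t(a)` (real numbers for states) for all `a` in the causal cone. -/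
def CausalLE (θ : ℝ) (A : Submodule ℂ 𝓢'(Plane, ℂ)) (s t : 𝓢'(Plane, ℂ) → ℂ) : Prop :=
  ∀ a ∈ causalCone θ A, (s a).re ≤ (t a).re

/-- The coherent state with parameter `κ`. -/
def coherentState (θ : ℝ) (κ : ℂ) : 𝓢'(Plane, ℂ) → ℂ := vectorState θ (coherentVec θ κ)

/-- `λ = (1 + i)/√2`. -/
def lam : ℂ := (1 + Complex.I) / (Real.sqrt 2 : ℂ)

end
end Moyal

/-!
Up to the factor `(2πθ)⁻¹`, the coherent state `ω_κ` is evaluation of a distribution against the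
Gaussian `f₀₀` translated to the point with complex coordinate `κ` (`coherentState_eq`). The
functions `f_{mn}` are explicit Laguerre polynomials times `f₀₀`
(`iterate_rightMul_iterate_leftMul`), so the double series is a rearrangement of the power series of
the translated Gaussian around the origin. The Schwartz seminorms of `z̄ʲ zᵏ f₀₀` are bounded by
multiples of `εʲ⁺ᵏ (j + k)!` for every `ε > 0`; hence the power series converges absolutely in the
Schwartz space, and the coherent states are finite on all tempered distributions. The largest
admissible `*`-algebra is therefore the whole multiplier algebra (`isGreatest_multipliers`). That the
multiplier algebra is closed under its product needs the continuity of `b ↦ a ⋆ b`, which holds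
because the Schwartz space is a Fréchet space and hence barrelled (`continuous_leftMul`).

Derivatives are derivations of the Moyal product, so the commutator of `∂_w` with left multiplication
by `a` is left multiplication by `∂_w a`. With the given Dirac matrices `𝒥[D, π(a)]` is diagonal, and
its entries are minus the derivatives of `a` along `e₀ - e₁` and `e₀ + e₁`. So a Hermitian multiplier
`a` is in the causal cone if and only if `⟨∂_v a, φ ⋆ φ*⟩ ≥ 0` for all Schwartz
functions `φ` and both light-like directions `v = e₀ ± e₁` (`mem_causalCone_multipliers`).

Since `f₀₀` and its translates are self-adjoint idempotents, they are themselves of the form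
`φ ⋆ φ*`; so for `a` in the cone the value of `a` on the translated Gaussian is nondecreasing when
the Gaussian moves along `e₀ ± e₁` (`apply_gaussAt_mono`). This gives the causal relation whenever
`κ₂ - κ₁` is in the light cone. Conversely, the linear functions `x₀ ± x₁` are multipliers in the
cone, and comparing their values on the two Gaussians forces `κ₂ - κ₁` to be in the light cone.
-/

namespace Moyal
noncomputable section
open MeasureTheory SchwartzMap LineDeriv FourierTransform
open scoped ContDiff RealInnerProductSpace

/-! ### The Moyal product as a superposition of plane waves -/

/-- The unimodular number `exp (2πi t)`. -/
def phase (t : ℝ) : ℂ := Complex.exp ((2 * Real.pi * t : ℝ) * Complex.I)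

theorem phase_add (s t : ℝ) : phase (s + t) = phase s * phase t := by
  rw [phase, phase, phase, ← Complex.exp_add]; push_cast; ring_nf

@[simp] theorem phase_zero : phase 0 = 1 := by simp [phase]

@[simp] theorem norm_phase (t : ℝ) : ‖phase t‖ = 1 := Complex.norm_exp_ofReal_mul_I _

theorem continuous_phase : Continuous phase := by unfold phase; fun_prop

theorem integrable_mul_phase {α : Type*} [TopologicalSpace α] [SecondCountableTopology α]
    [MeasurableSpace α] [OpensMeasurableSpace α]
    {μ : Measure α} {F : α → ℂ} (hF : Integrable F μ) {q : α → ℝ} (hq : Continuous q) :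
    Integrable (fun a => F a * phase (q a)) μ :=
  hF.mul_bdd (c := 1) (continuous_phase.comp hq).aestronglyMeasurable
    (Filter.Eventually.of_forall fun a => by simp)

theorem fourier_apply_phase (f : 𝓢(Plane, ℂ)) (ξ : Plane) :
    𝓕 f ξ = ∫ x, f x * phase (-⟪ξ, x⟫) := by
  rw [SchwartzMap.fourier_coe, Real.fourier_eq']
  refine integral_congr_ae (Filter.Eventually.of_forall fun x => ?_)
  simp only [phase, smul_eq_mul, real_inner_comm x ξ]
  rw [mul_comm]
  congr 3
  push_cast; ring

theorem fourierInv_apply_neg (f : 𝓢(Plane, ℂ)) (ξ : Plane) : 𝓕⁻ f ξ = 𝓕 f (-ξ) := by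
  rw [SchwartzMap.fourierInv_apply_eq]; rfl

theorem rot_rot (x : Plane) : rot (rot x) = -x := by
  rw [rot_apply (rot x), rot_apply x]
  ext i; fin_cases i <;> simp

theorem inner_rot_left (x y : Plane) : ⟪rot x, y⟫ = -⟪x, rot y⟫ := by
  simp [rot_apply, PiLp.inner_apply, Fin.sum_univ_two]

theorem inner_rot_self (x : Plane) : ⟪x, rot x⟫ = 0 := by
  simp [rot_apply, PiLp.inner_apply, Fin.sum_univ_two]; ring

theorem norm_rot (x : Plane) : ‖rot x‖ = ‖x‖ := by
  simp [rot_apply, EuclideanSpace.norm_eq, Fin.sum_univ_two, add_comm]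

/-- The rotation `rot` as a linear isometric equivalence. -/
def rotIso : Plane ≃ₗᵢ[ℝ] Plane :=
  LinearIsometry.toLinearIsometryEquiv ⟨rot.toLinearMap, norm_rot⟩ rfl

theorem rotIso_apply (x : Plane) : rotIso x = rot x := rfl

theorem integral_comp_smul_rot (F : Plane → ℂ) (c : ℝ) :
    ∫ x, F (c • rot x) = ((c ^ 2)⁻¹ : ℝ) * ∫ x, F x := by
  have h1 := rotIso.measurePreserving.integral_comp
    rotIso.toHomeomorph.measurableEmbedding (fun y => F (c • y))
  simp only [rotIso_apply] at h1
  rw [h1, Measure.integral_comp_smul]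
  simp

theorem wedge_eq_inner_rot {θ : ℝ} (hθ : θ ≠ 0) (y z : Plane) :
    Complex.exp (-2 * Complex.I * ((∑ μ, ∑ ν, y μ * (Theta θ)⁻¹ μ ν * z ν : ℝ) : ℂ)) =
      phase (-⟪(Real.pi * θ)⁻¹ • rot y, z⟫) := by
  rw [Theta_inv θ hθ, phase, inner_smul_left]
  congr 1
  have hπ : (Real.pi : ℂ) ≠ 0 := by exact_mod_cast Real.pi_ne_zero
  have hθ' : (θ : ℂ) ≠ 0 := by exact_mod_cast hθ
  simp only [Fin.sum_univ_two, PiLp.inner_apply, rot_apply]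
  simp
  field_simp
  ring

/-- `f ⋆ g` is the superposition, with the weights `𝓕 g ξ`, of the products of `f` with plane waves;
multiplying by a plane wave from the right shifts `f` and multiplies it by the wave. -/
theorem moyal_eq_integral {θ : ℝ} (hθ : θ ≠ 0) (f g : 𝓢(Plane, ℂ)) (x : Plane) :
    moyal θ f g x = ∫ ξ, 𝓕 g ξ * phase ⟪ξ, x⟫ * f (x - (Real.pi * θ) • rot ξ) := by
  have hσ : Real.pi * θ ≠ 0 := mul_ne_zero Real.pi_ne_zero hθ
  set σ := Real.pi * θ with hσd
  set H : Plane → ℂ := fun y => f (x + y) * (phase ⟪σ⁻¹ • rot y, x⟫ * 𝓕 g (σ⁻¹ • rot y)) with hH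
  have h1 : ∫ p : Plane × Plane, f (x + p.1) * g (x + p.2) *
      Complex.exp (-2 * Complex.I * ((∑ μ, ∑ ν, p.1 μ * (Theta θ)⁻¹ μ ν * p.2 ν : ℝ) : ℂ)) =
      ∫ y, H y := by
    simp_rw [wedge_eq_inner_rot hθ]
    have hint : Integrable (fun p : Plane × Plane => f (x + p.1) * g (x + p.2) *
        phase (-⟪σ⁻¹ • rot p.1, p.2⟫)) (volume.prod volume) :=
      integrable_mul_phase ((f.integrable.comp_add_left x).mul_prod (g.integrable.comp_add_left x))
        (by fun_prop)
    rw [Measure.volume_eq_prod, integral_prod _ hint]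
    refine integral_congr_ae (Filter.Eventually.of_forall fun y => ?_)
    simp only [hH, mul_assoc]
    rw [integral_const_mul, fourier_apply_phase, ← integral_const_mul (phase _),
      ← integral_add_left_eq_self (fun z => phase _ * _) x]
    congr 2
    funext z
    have h2 : phase (-⟪σ⁻¹ • rot y, z⟫) =
        phase ⟪σ⁻¹ • rot y, x⟫ * phase (-⟪σ⁻¹ • rot y, x + z⟫) := by
      rw [← phase_add]; congr 1; rw [inner_add_right]; ring
    rw [h2]; ring
  rw [moyal_apply, moyalFun, h1]
  have h3 := integral_comp_smul_rot H (-σ)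
  rw [neg_sq] at h3
  rw [← h3]
  refine integral_congr_ae (Filter.Eventually.of_forall fun ξ => ?_)
  have h4 : σ⁻¹ • rot (-σ • rot ξ) = ξ := by
    rw [map_smul, rot_rot, smul_neg, neg_smul, neg_neg, smul_smul, inv_mul_cancel₀ hσ, one_smul]
  simp only [hH]
  rw [h4, neg_smul, ← sub_eq_add_neg]
  ring

theorem integrable_moyal_integrand {θ : ℝ} (f g : 𝓢(Plane, ℂ)) (x : Plane) :
    Integrable (fun ξ => 𝓕 g ξ * phase ⟪ξ, x⟫ * f (x - (Real.pi * θ) • rot ξ)) := by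
  obtain ⟨C, hC⟩ := f.toBoundedContinuousFunction.isBounded_range.exists_norm_le
  refine Integrable.mul_bdd (c := C) ?_ (by fun_prop) (Filter.Eventually.of_forall fun ξ => ?_)
  · exact integrable_mul_phase (SchwartzMap.integrable _) (by fun_prop)
  · exact hC _ ⟨_, rfl⟩

/-- The Fourier transform turns the Moyal product into a twisted convolution. -/
theorem fourier_moyal {θ : ℝ} (hθ : θ ≠ 0) (f g : 𝓢(Plane, ℂ)) (m : Plane) :
    𝓕 (moyal θ f g) m =
      ∫ l, 𝓕 g l * phase (-⟪m - l, (Real.pi * θ) • rot l⟫) * 𝓕 f (m - l) := by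
  set σ := Real.pi * θ
  rw [fourier_apply_phase]
  simp_rw [moyal_eq_integral hθ, ← integral_mul_const]
  rw [integral_integral_swap]
  · refine integral_congr_ae (Filter.Eventually.of_forall fun l => ?_)
    simp only
    rw [fourier_apply_phase f, ← integral_const_mul,
      ← integral_sub_right_eq_self (fun x => _ * _ * (f x * _)) (σ • rot l)]
    refine integral_congr_ae (Filter.Eventually.of_forall fun x => ?_)
    have : phase ⟪l, x⟫ * phase (-⟪m, x⟫) =
        phase (-⟪m - l, σ • rot l⟫) * phase (-⟪m - l, x - σ • rot l⟫) := by
      rw [← phase_add, ← phase_add]; congr 1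
      simp only [inner_sub_left, inner_sub_right]; ring
    simp only
    linear_combination (𝓕 g l * f (x - σ • rot l)) * this
  · have h1 : Integrable (fun p : Plane × Plane => 𝓕 g p.1 * f p.2) (volume.prod volume) :=
      (SchwartzMap.integrable _).mul_prod f.integrable
    have h2 : MeasurePreserving (fun p : Plane × Plane => (p.1, -(σ • rot p.1) + p.2))
        (volume.prod volume) (volume.prod volume) :=
      (MeasurePreserving.id volume).skew_product (g := fun l x => -(σ • rot l) + x)
        (by fun_prop) (Filter.Eventually.of_forall fun l => map_add_left_eq_self _ _)
    have h3 : Integrable (fun p : Plane × Plane => 𝓕 g p.1 * f (-(σ • rot p.1) + p.2))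
        (volume.prod volume) :=
      h2.integrable_comp_of_integrable h1
    have h4 := integrable_mul_phase (integrable_mul_phase h3.swap (q := fun p => ⟪p.2, p.1⟫)
      (by fun_prop)) (q := fun p => -⟪m, p.1⟫) (by fun_prop)
    refine h4.congr (Filter.Eventually.of_forall fun p => ?_)
    simp only [Function.comp_apply, Function.uncurry, Prod.fst_swap, Prod.snd_swap,
      neg_add_eq_sub]
    ring

/-- The trace property of the Moyal product. -/
theorem integral_moyal {θ : ℝ} (hθ : θ ≠ 0) (f g : 𝓢(Plane, ℂ)) :
    ∫ x, moyal θ f g x = ∫ x, f x * g x := by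
  have h1 : ∫ x, moyal θ f g x = 𝓕 (moyal θ f g) 0 := by simp [fourier_apply_phase]
  have h2 : ∫ x, 𝓕 g x * 𝓕⁻ f x = ∫ x, g x * f x := by
    rw [SchwartzMap.integral_fourier_mul_eq, FourierTransform.fourier_fourierInv_eq]
  rw [h1, fourier_moyal hθ]
  simp_rw [mul_comm (f _), ← h2, fourierInv_apply_neg]
  refine integral_congr_ae (Filter.Eventually.of_forall fun l => ?_)
  simp [inner_smul_right, inner_rot_self]

theorem moyal_assoc {θ : ℝ} (hθ : θ ≠ 0) (f g h : 𝓢(Plane, ℂ)) :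
    moyal θ (moyal θ f g) h = moyal θ f (moyal θ g h) := by
  ext x
  set σ := Real.pi * θ with hσ
  rw [moyal_eq_integral hθ, moyal_eq_integral hθ]
  simp_rw [moyal_eq_integral hθ f g, fourier_moyal hθ, ← integral_const_mul, ← integral_mul_const]
  rw [integral_integral_swap (f := fun m l => 𝓕 h l * phase (-⟪m - l, σ • rot l⟫) *
    𝓕 g (m - l) * phase ⟪m, x⟫ * f (x - σ • rot m))]
  · refine integral_congr_ae (Filter.Eventually.of_forall fun l => ?_)
    simp only
    rw [← integral_add_right_eq_self (fun m => 𝓕 h l * phase (-⟪m - l, σ • rot l⟫) *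
      𝓕 g (m - l) * phase ⟪m, x⟫ * f (x - σ • rot m)) l]
    refine integral_congr_ae (Filter.Eventually.of_forall fun k => ?_)
    have h1 : phase ⟪l, x⟫ * phase ⟪k, x - σ • rot l⟫ =
        phase (-⟪k, σ • rot l⟫) * phase ⟪k + l, x⟫ := by
      rw [← phase_add, ← phase_add]; congr 1
      simp only [inner_add_left, inner_sub_right]; ring
    have h2 : x - σ • rot (k + l) = x - σ • rot l - σ • rot k := by
      rw [map_add, smul_add]; abel
    simp only [add_sub_cancel_right, h2]
    linear_combination (𝓕 h l * 𝓕 g k * f (x - σ • rot l - σ • rot k)) * h1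
  · obtain ⟨C, hC⟩ := f.toBoundedContinuousFunction.isBounded_range.exists_norm_le
    have h1 : Integrable (fun p : Plane × Plane => 𝓕 h p.1 * 𝓕 g p.2) (volume.prod volume) :=
      (SchwartzMap.integrable _).mul_prod (SchwartzMap.integrable _)
    have h2 : MeasurePreserving (fun p : Plane × Plane => (p.1, -p.1 + p.2))
        (volume.prod volume) (volume.prod volume) :=
      (MeasurePreserving.id volume).skew_product (g := fun l x => -l + x)
        (by fun_prop) (Filter.Eventually.of_forall fun l => map_add_left_eq_self _ _)
    have h3 : Integrable (fun p : Plane × Plane => 𝓕 h p.1 * 𝓕 g (-p.1 + p.2))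
        (volume.prod volume) := h2.integrable_comp_of_integrable h1
    have h4 := integrable_mul_phase (integrable_mul_phase h3.swap
      (q := fun p => -⟪p.1 - p.2, σ • rot p.2⟫) (by fun_prop)) (q := fun p => ⟪p.1, x⟫)
      (by fun_prop)
    have h5 := h4.mul_bdd (g := fun p => f (x - σ • rot p.1)) (c := C) (by fun_prop)
      (Filter.Eventually.of_forall fun ξ => hC _ ⟨_, rfl⟩)
    refine h5.congr (Filter.Eventually.of_forall fun p => ?_)
    simp only [Function.comp_apply, Function.uncurry, Prod.fst_swap, Prod.snd_swap,
      neg_add_eq_sub]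
    ring

theorem conjS_conjS (f : 𝓢(Plane, ℂ)) : conjS (conjS f) = f := by
  ext x; simp [conjS_apply]

theorem conjS_moyal {θ : ℝ} (hθ : θ ≠ 0) (f g : 𝓢(Plane, ℂ)) :
    conjS (moyal θ f g) = moyal θ (conjS g) (conjS f) := by
  ext x
  rw [conjS_apply, moyal_apply, moyal_apply, moyalFun, moyalFun, map_mul, ← integral_conj,
    Complex.conj_ofReal]
  simp_rw [wedge_eq_inner_rot hθ, conjS_apply]
  rw [Measure.volume_eq_prod, ← integral_prod_swap]
  congr 2
  funext p
  have : conj (phase (-⟪(Real.pi * θ)⁻¹ • rot p.swap.1, p.swap.2⟫)) =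
      phase (-⟪(Real.pi * θ)⁻¹ • rot p.1, p.2⟫) := by
    have h1 : ⟪(Real.pi * θ)⁻¹ • rot p.swap.1, p.swap.2⟫ =
        -⟪(Real.pi * θ)⁻¹ • rot p.1, p.2⟫ := by
      rw [inner_smul_left, inner_smul_left, Prod.fst_swap, Prod.snd_swap, inner_rot_left,
        real_inner_comm]
      simp
    rw [h1, phase, phase, ← Complex.exp_conj, map_mul, Complex.conj_ofReal, Complex.conj_I]
    congr 1
    push_cast
    ring
  rw [map_mul, map_mul, this]
  simp only [Prod.fst_swap, Prod.snd_swap]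
  ring

/-- The Moyal product is translation invariant. -/
theorem moyal_translate (θ : ℝ) (c : Plane) (f g : 𝓢(Plane, ℂ)) :
    moyal θ (compSubConstCLM ℂ c f) (compSubConstCLM ℂ c g) =
      compSubConstCLM ℂ c (moyal θ f g) := by
  ext x
  rw [compSubConstCLM_apply, moyal_apply, moyal_apply, moyalFun, moyalFun]
  simp only [compSubConstCLM_apply, add_sub_right_comm]

theorem integral_moyal_mul {θ : ℝ} (hθ : θ ≠ 0) (f g h : 𝓢(Plane, ℂ)) :
    ∫ x, moyal θ f g x * h x = ∫ x, f x * moyal θ g h x := by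
  rw [← integral_moyal hθ, moyal_assoc hθ, integral_moyal hθ]

/-! ### Linear functions and derivations of the Moyal product -/

/-- The linear function `x ↦ ⟪w, x⟫`, with complex values. -/
def linFun (w : Plane) (x : Plane) : ℂ := (⟪w, x⟫ : ℝ)

theorem linFun_hasTemperateGrowth (w : Plane) : (linFun w).HasTemperateGrowth :=
  (Complex.ofRealCLM.comp (innerSL ℝ w)).hasTemperateGrowth

/-- Multiplication of Schwartz functions by the linear function `x ↦ ⟪w, x⟫`. -/
def mulLin (w : Plane) : 𝓢(Plane, ℂ) →L[ℂ] 𝓢(Plane, ℂ) := smulLeftCLM ℂ (linFun w)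

theorem mulLin_apply (w : Plane) (f : 𝓢(Plane, ℂ)) (x : Plane) :
    mulLin w f x = (⟪w, x⟫ : ℝ) * f x := by
  rw [mulLin, smulLeftCLM_apply_apply (linFun_hasTemperateGrowth w)]; rfl

theorem conjS_mulLin (w : Plane) (f : 𝓢(Plane, ℂ)) :
    conjS (mulLin w f) = mulLin w (conjS f) := by
  ext x; simp [conjS_apply, mulLin_apply]

theorem conjS_lineDeriv (w : Plane) (f : 𝓢(Plane, ℂ)) :
    conjS (∂_{w} f) = ∂_{w} (conjS f) := by
  ext x
  rw [conjS_apply, lineDerivOp_apply_eq_fderiv, lineDerivOp_apply_eq_fderiv]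
  have h1 : HasFDerivAt (conjS f) ((Complex.conjCLE : ℂ →L[ℝ] ℂ) ∘L fderiv ℝ f x) x :=
    (Complex.conjCLE : ℂ →L[ℝ] ℂ).hasFDerivAt.comp x (f.hasFDerivAt x)
  rw [h1.fderiv]; rfl

theorem integrable_mul (f g : 𝓢(Plane, ℂ)) : Integrable (fun x => f x * g x) := by
  obtain ⟨C, hC⟩ := g.toBoundedContinuousFunction.isBounded_range.exists_norm_le
  exact f.integrable.mul_bdd (c := C) (by fun_prop)
    (Filter.Eventually.of_forall fun ξ => hC _ ⟨_, rfl⟩)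

/-- The bilinear pairing `∫ f g` of Schwartz functions. -/
def pair (f g : 𝓢(Plane, ℂ)) : ℂ := ∫ x, f x * g x

theorem pair_comm (f g : 𝓢(Plane, ℂ)) : pair f g = pair g f := by
  simp only [pair, mul_comm]

theorem pair_add_left (f g h : 𝓢(Plane, ℂ)) : pair (f + g) h = pair f h + pair g h := by
  simp only [pair, add_apply, add_mul]
  exact integral_add (integrable_mul _ _) (integrable_mul _ _)

theorem pair_smul_left (c : ℂ) (f g : 𝓢(Plane, ℂ)) : pair (c • f) g = c * pair f g := by
  simp only [pair, smul_apply, smul_eq_mul, mul_assoc, integral_const_mul]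

theorem pair_sub_left (f g h : 𝓢(Plane, ℂ)) : pair (f - g) h = pair f h - pair g h := by
  simp only [pair, sub_apply, sub_mul]
  exact integral_sub (integrable_mul _ _) (integrable_mul _ _)

theorem pair_lineDeriv_left (w : Plane) (f g : 𝓢(Plane, ℂ)) :
    pair (∂_{w} f) g = -pair f (∂_{w} g) := by
  rw [pair, pair, SchwartzMap.integral_mul_lineDerivOp_right_eq_neg_left, neg_neg]

theorem pair_moyal {θ : ℝ} (hθ : θ ≠ 0) (f g h : 𝓢(Plane, ℂ)) :
    pair (moyal θ f g) h = pair f (moyal θ g h) := integral_moyal_mul hθ f g h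

theorem pair_moyal_cyclic {θ : ℝ} (hθ : θ ≠ 0) (f g h : 𝓢(Plane, ℂ)) :
    pair (moyal θ f g) h = pair (moyal θ g h) f := by rw [pair_moyal hθ, pair_comm]

theorem pair_conjS_self (f : 𝓢(Plane, ℂ)) : pair f (conjS f) = ((∫ x, ‖f x‖ ^ 2 : ℝ) : ℂ) := by
  rw [pair, ← integral_complex_ofReal]
  congr 1; funext x
  rw [conjS_apply, Complex.mul_conj, Complex.normSq_eq_norm_sq]

theorem eq_zero_of_pair_eq_zero {f : 𝓢(Plane, ℂ)} (h : ∀ g, pair f g = 0) : f = 0 := by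
  have h1 := h (conjS f)
  rw [pair_conjS_self, Complex.ofReal_eq_zero, integral_eq_zero_iff_of_nonneg] at h1
  · have h2 : (fun x => ‖f x‖ ^ 2) = 0 :=
      (Continuous.ae_eq_iff_eq volume (by fun_prop) continuous_const).1 h1
    ext x
    simpa using congrFun h2 x
  · intro x; positivity
  · have := (integrable_mul f (conjS f)).norm
    refine this.congr (Filter.Eventually.of_forall fun x => ?_)
    simp [conjS_apply, sq]

theorem eq_of_pair_eq {f g : 𝓢(Plane, ℂ)} (h : ∀ u, pair f u = pair g u) : f = g :=
  sub_eq_zero.1 (eq_zero_of_pair_eq_zero fun u => by rw [pair_sub_left, h, sub_self])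

/-- A linear function can be moved out of a product at the price of a derivative of the other factor:
in `moyal_eq_integral`, `⟪w, ·⟫` is evaluated at the shifted point `x - πθ rot ξ`, and the frequency
`ξ` in the shift is a derivative of `g`. -/
theorem moyal_mulLin_left {θ : ℝ} (hθ : θ ≠ 0) (w : Plane) (f g : 𝓢(Plane, ℂ)) :
    moyal θ (mulLin w f) g =
      mulLin w (moyal θ f g) - (Complex.I * θ / 2) • moyal θ f (∂_{rot w} g) := by
  ext x
  rw [sub_apply, smul_apply, smul_eq_mul, mulLin_apply, moyal_eq_integral hθ,
    moyal_eq_integral hθ, moyal_eq_integral hθ, ← integral_const_mul, ← integral_const_mul,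
    ← integral_sub ((integrable_moyal_integrand f g x).const_mul _)
      ((integrable_moyal_integrand f _ x).const_mul _)]
  refine integral_congr_ae (Filter.Eventually.of_forall fun ξ => ?_)
  simp only [mulLin_apply]
  have h0 : (fun y : Plane => (⟪y, rot w⟫ : ℝ)).HasTemperateGrowth := by fun_prop
  rw [SchwartzMap.fourier_lineDerivOp_eq, smul_apply, smulLeftCLM_apply_apply h0,
    inner_sub_right, inner_smul_right, real_inner_comm (rot w) ξ, inner_rot_left]
  simp only [smul_eq_mul, Complex.real_smul]
  push_cast
  linear_combination (-θ * Real.pi * ⟪w, rot ξ⟫ * 𝓕 g ξ * phase ⟪ξ, x⟫ *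
    f (x - (Real.pi * θ) • rot ξ)) * Complex.I_sq

theorem moyal_mulLin_right {θ : ℝ} (hθ : θ ≠ 0) (w : Plane) (f g : 𝓢(Plane, ℂ)) :
    moyal θ f (mulLin w g) =
      mulLin w (moyal θ f g) + (Complex.I * θ / 2) • moyal θ (∂_{rot w} f) g := by
  rw [← conjS_conjS (moyal θ f (mulLin w g)), conjS_moyal hθ, conjS_mulLin, moyal_mulLin_left hθ,
    map_sub, conjS_mulLin, conjS_moyal hθ, conjS_conjS, conjS_conjS, ← conjS_lineDeriv]
  ext x
  simp only [sub_apply, add_apply, conjS_apply, smul_apply, smul_eq_mul,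
    map_mul]
  rw [← conjS_apply, conjS_moyal hθ, conjS_conjS, conjS_conjS]
  rw [map_div₀, map_mul, Complex.conj_I, Complex.conj_ofReal, map_ofNat]
  ring

/-- Derivatives are derivations of the Moyal product. They are commutators with linear functions; in
weak form, `∫ (f ⋆ g) h` is a cyclic trilinear form, and the sum over the cyclic permutations of the
commutation relation of a linear function with two neighbouring factors is zero on one side and
twice the Leibniz rule on the other. -/
theorem lineDeriv_moyal_rot {θ : ℝ} (hθ : θ ≠ 0) (w : Plane) (f g : 𝓢(Plane, ℂ)) :
    ∂_{rot w} (moyal θ f g) = moyal θ (∂_{rot w} f) g + moyal θ f (∂_{rot w} g) := by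
  have key (f g h : 𝓢(Plane, ℂ)) :
      pair (moyal θ (mulLin w f) g) h - pair (moyal θ f (mulLin w g)) h =
      - (Complex.I * θ / 2) * (pair (moyal θ (∂_{rot w} f) g) h +
        pair (moyal θ f (∂_{rot w} g)) h) := by
    rw [moyal_mulLin_left hθ, moyal_mulLin_right hθ, pair_sub_left, pair_add_left,
      pair_smul_left, pair_smul_left]
    ring
  refine eq_of_pair_eq fun h => ?_
  -- `key` for the three cyclic permutations of `f`, `g`, `h`, brought to the form `∫ (f ⋆ g) h`
  have k1 := key f g h
  have k2 := key g h f
  have k3 := key h f g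
  rw [← pair_moyal_cyclic hθ f, ← pair_moyal_cyclic hθ f, ← pair_moyal_cyclic hθ f,
    ← pair_moyal_cyclic hθ f] at k2
  rw [pair_moyal_cyclic hθ _ f, pair_moyal_cyclic hθ h, pair_moyal_cyclic hθ _ f,
    pair_moyal_cyclic hθ h] at k3
  have k4 : (Complex.I * θ / 2) * (pair (moyal θ (∂_{rot w} f) g) h +
      pair (moyal θ f (∂_{rot w} g)) h + pair (moyal θ f g) (∂_{rot w} h)) = 0 := by
    linear_combination (1 / 2 : ℂ) * (k1 + k2 + k3)
  have k5 := (mul_eq_zero.1 k4).resolve_left (by simp [hθ])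
  rw [pair_lineDeriv_left, pair_add_left]
  linear_combination -k5

theorem lineDeriv_moyal {θ : ℝ} (hθ : θ ≠ 0) (w : Plane) (f g : 𝓢(Plane, ℂ)) :
    ∂_{w} (moyal θ f g) = moyal θ (∂_{w} f) g + moyal θ f (∂_{w} g) := by
  have h := lineDeriv_moyal_rot hθ (-rot w) f g
  rwa [map_neg, rot_rot, neg_neg] at h

/-! ### Products with multipliers -/

theorem leftMul_spec {θ : ℝ} {a : 𝓢'(Plane, ℂ)} (ha : IsMultiplier θ a) (b g : 𝓢(Plane, ℂ)) :
    a (moyal θ b g) = pair (leftMul θ a b) g := by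
  have h := (ha b).1
  rw [leftMul, dif_pos h]
  exact h.choose_spec g

theorem rightMul_spec {θ : ℝ} {a : 𝓢'(Plane, ℂ)} (ha : IsMultiplier θ a) (b g : 𝓢(Plane, ℂ)) :
    a (moyal θ g b) = pair (rightMul θ a b) g := by
  have h := (ha b).2
  rw [rightMul, dif_pos h]
  exact h.choose_spec g

theorem leftMul_eq {θ : ℝ} {a : 𝓢'(Plane, ℂ)} {b c : 𝓢(Plane, ℂ)} (h : IsLeftMul θ a b c) :
    leftMul θ a b = c := by
  have h' : ∃ c, IsLeftMul θ a b c := ⟨c, h⟩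
  rw [leftMul, dif_pos h']
  exact eq_of_pair_eq fun g => (h'.choose_spec g).symm.trans (h g)

theorem rightMul_eq {θ : ℝ} {a : 𝓢'(Plane, ℂ)} {b c : 𝓢(Plane, ℂ)} (h : IsRightMul θ a b c) :
    rightMul θ a b = c := by
  have h' : ∃ c, IsRightMul θ a b c := ⟨c, h⟩
  rw [rightMul, dif_pos h']
  exact eq_of_pair_eq fun g => (h'.choose_spec g).symm.trans (h g)

theorem IsLeftMul.add {θ : ℝ} {a a' : 𝓢'(Plane, ℂ)} {b c c' : 𝓢(Plane, ℂ)}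
    (h : IsLeftMul θ a b c) (h' : IsLeftMul θ a' b c') : IsLeftMul θ (a + a') b (c + c') :=
  fun g => (congrArg₂ (· + ·) (h g) (h' g)).trans (pair_add_left c c' g).symm

theorem IsRightMul.add {θ : ℝ} {a a' : 𝓢'(Plane, ℂ)} {b c c' : 𝓢(Plane, ℂ)}
    (h : IsRightMul θ a b c) (h' : IsRightMul θ a' b c') : IsRightMul θ (a + a') b (c + c') :=
  fun g => (congrArg₂ (· + ·) (h g) (h' g)).trans (pair_add_left c c' g).symm

theorem IsLeftMul.smul {θ : ℝ} {a : 𝓢'(Plane, ℂ)} {b c : 𝓢(Plane, ℂ)}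
    (h : IsLeftMul θ a b c) (k : ℂ) : IsLeftMul θ (k • a) b (k • c) :=
  fun g => (congrArg (k * ·) (h g)).trans (pair_smul_left k c g).symm

theorem IsRightMul.smul {θ : ℝ} {a : 𝓢'(Plane, ℂ)} {b c : 𝓢(Plane, ℂ)}
    (h : IsRightMul θ a b c) (k : ℂ) : IsRightMul θ (k • a) b (k • c) :=
  fun g => (congrArg (k * ·) (h g)).trans (pair_smul_left k c g).symm

/-- The linear function `x ↦ ⟪w, x⟫` as a tempered distribution. -/
def linDist (w : Plane) : 𝓢'(Plane, ℂ) := (linFun_hasTemperateGrowth w).toTemperedDistribution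

theorem linDist_apply (w : Plane) (f : 𝓢(Plane, ℂ)) : linDist w f = ∫ x, mulLin w f x := by
  rw [linDist, Function.HasTemperateGrowth.toTemperedDistribution_apply volume]
  congr 1; funext x
  rw [mulLin_apply, smul_eq_mul, mul_comm]; rfl

theorem isLeftMul_linDist {θ : ℝ} (hθ : θ ≠ 0) (w : Plane) (b : 𝓢(Plane, ℂ)) :
    IsLeftMul θ (linDist w) b (mulLin w b - (Complex.I * θ / 2) • ∂_{rot w} b) := by
  intro g
  change _ = pair _ g
  have h : mulLin w (moyal θ b g) =
      moyal θ (mulLin w b) g + (Complex.I * θ / 2) • moyal θ b (∂_{rot w} g) := by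
    rw [moyal_mulLin_left hθ]; abel
  rw [linDist_apply, h, pair_sub_left, pair_smul_left, pair_lineDeriv_left]
  simp only [add_apply, smul_apply]
  rw [integral_add (SchwartzMap.integrable _) ((SchwartzMap.integrable _).fun_smul _),
    integral_smul, integral_moyal hθ, integral_moyal hθ, smul_eq_mul, pair, pair]
  ring

theorem isRightMul_linDist {θ : ℝ} (hθ : θ ≠ 0) (w : Plane) (b : 𝓢(Plane, ℂ)) :
    IsRightMul θ (linDist w) b (mulLin w b + (Complex.I * θ / 2) • ∂_{rot w} b) := by
  intro g
  change _ = pair _ g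
  have h : mulLin w (moyal θ g b) =
      moyal θ g (mulLin w b) - (Complex.I * θ / 2) • moyal θ (∂_{rot w} g) b := by
    rw [moyal_mulLin_right hθ]; abel
  rw [linDist_apply, h, pair_add_left, pair_smul_left, pair_lineDeriv_left, pair_comm,
    pair_comm b]
  simp only [sub_apply, smul_apply]
  rw [integral_sub (SchwartzMap.integrable _) ((SchwartzMap.integrable _).fun_smul _),
    integral_smul, integral_moyal hθ, integral_moyal hθ, smul_eq_mul, pair, pair]
  ring

theorem isMultiplier_linDist {θ : ℝ} (hθ : θ ≠ 0) (w : Plane) : IsMultiplier θ (linDist w) :=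
  fun b => ⟨⟨_, isLeftMul_linDist hθ w b⟩, ⟨_, isRightMul_linDist hθ w b⟩⟩

theorem adj_linDist (w : Plane) : adj (linDist w) = linDist w := by
  ext f
  rw [adj_apply, linDist_apply, linDist_apply, ← integral_conj]
  congr 1; funext x
  rw [← conjS_mulLin, conjS_apply, Complex.conj_conj]

/-! ### The Gaussian is an idempotent -/

theorem f00_apply_norm {θ : ℝ} (hθ : 0 < θ) (x : Plane) :
    f00 θ x = 2 * Complex.exp (-(θ⁻¹ : ℂ) * (‖x‖ ^ 2 : ℝ)) := by
  rw [f00, dif_pos hθ, smul_apply, smul_eq_mul]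
  change 2 * Complex.exp (((-θ⁻¹ : ℝ) : ℂ) * ((‖x‖ ^ 2 : ℝ) : ℂ)) = _
  push_cast; rfl

theorem conjS_f00 {θ : ℝ} (hθ : 0 < θ) : conjS (f00 θ) = f00 θ := by
  ext x
  rw [conjS_apply, f00_apply_norm hθ, map_mul, ← Complex.exp_conj, map_ofNat]
  simp

theorem fourier_f00 {θ : ℝ} (hθ : 0 < θ) (ξ : Plane) :
    𝓕 (f00 θ) ξ = 2 * Real.pi * θ * Complex.exp (-(Real.pi ^ 2 * θ : ℂ) * (‖ξ‖ ^ 2 : ℝ)) := by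
  have h1 := fourier_gaussian_innerProductSpace (V := Plane) (b := (θ⁻¹ : ℂ))
    (by rw [← Complex.ofReal_inv, Complex.ofReal_re]; positivity) ξ
  have h2 : (f00 θ : Plane → ℂ) =
      (2 : ℂ) • (fun v : Plane => Complex.exp (-(θ⁻¹ : ℂ) * (‖v‖ : ℂ) ^ 2)) := by
    funext x; rw [f00_apply_norm hθ]; simp
  rw [SchwartzMap.fourier_coe, h2, Real.fourier_eq]
  simp only [Pi.smul_apply, smul_comm _ (2 : ℂ), integral_smul]
  rw [← Real.fourier_eq, h1]
  have hθ' : (θ : ℂ) ≠ 0 := by exact_mod_cast hθ.ne'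
  simp [div_eq_mul_inv]
  ring_nf

theorem integral_cexp_neg_sq_add (b : ℂ) (hb : 0 < b.re) (c : Fin 2 → ℂ) :
    ∫ ξ : Plane, Complex.exp (-b * (‖ξ‖ ^ 2 : ℝ) + ∑ i, c i * ξ i) =
      Real.pi / b * Complex.exp ((c 0 ^ 2 + c 1 ^ 2) / (4 * b)) := by
  have h := GaussianFourier.integral_cexp_neg_sum_mul_add (b := fun _ : Fin 2 => b)
    (fun _ => hb) c
  have hb0 : (Real.pi / b : ℂ) ≠ 0 := by
    refine div_ne_zero (by exact_mod_cast Real.pi_ne_zero) ?_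
    rintro rfl; simp at hb
  rw [← (EuclideanSpace.volume_preserving_symm_measurableEquiv_toLp (Fin 2)).symm.integral_comp
    (MeasurableEquiv.measurableEmbedding _)]
  simp only [Fin.prod_univ_two] at h
  rw [mul_mul_mul_comm, ← Complex.exp_add, ← Complex.cpow_add _ _ hb0] at h
  norm_num at h
  rw [← add_div] at h
  rw [← h]
  congr 1; funext v
  congr 1
  simp [EuclideanSpace.norm_sq_eq, Fin.sum_univ_two]
  ring

/-- `f₀₀` is the projection onto the vacuum. The Gaussian integral has the value expected of a
projection because its linear term is isotropic. -/
theorem moyal_f00_f00 {θ : ℝ} (hθ : 0 < θ) : moyal θ (f00 θ) (f00 θ) = f00 θ := by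
  ext x
  have hθ' : (θ : ℂ) ≠ 0 := by exact_mod_cast hθ.ne'
  have hπ : (Real.pi : ℂ) ≠ 0 := by exact_mod_cast Real.pi_ne_zero
  rw [moyal_eq_integral hθ.ne']
  set c : Fin 2 → ℂ :=
    ![2 * Real.pi * (Complex.I * x 0 - x 1), 2 * Real.pi * (Complex.I * x 1 + x 0)]
    with hc
  have h0 : c 0 ^ 2 + c 1 ^ 2 = 0 := by
    simp only [hc, Matrix.cons_val_zero, Matrix.cons_val_one]
    linear_combination (4 * Real.pi ^ 2 * ((x 0 : ℂ) ^ 2 + (x 1 : ℂ) ^ 2)) * Complex.I_sq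
  have h1 : ∀ ξ : Plane, 𝓕 (f00 θ) ξ * phase ⟪ξ, x⟫ * f00 θ (x - (Real.pi * θ) • rot ξ) =
      (4 * Real.pi * θ * Complex.exp (-(θ⁻¹ : ℂ) * (‖x‖ ^ 2 : ℝ))) *
      Complex.exp (-(2 * Real.pi ^ 2 * θ : ℂ) * (‖ξ‖ ^ 2 : ℝ) + ∑ i, c i * ξ i) := by
    intro ξ
    rw [fourier_f00 hθ, f00_apply_norm hθ, phase]
    calc _ = 4 * Real.pi * θ * (Complex.exp (-(Real.pi ^ 2 * θ : ℂ) * (‖ξ‖ ^ 2 : ℝ)) *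
          Complex.exp ((2 * Real.pi * ⟪ξ, x⟫ : ℝ) * Complex.I) *
          Complex.exp (-(θ⁻¹ : ℂ) * (‖x - (Real.pi * θ) • rot ξ‖ ^ 2 : ℝ))) := by ring
      _ = _ := by
        rw [← Complex.exp_add, ← Complex.exp_add, mul_assoc (4 * Real.pi * θ : ℂ),
          ← Complex.exp_add]
        congr 2
        simp only [EuclideanSpace.norm_sq_eq, Fin.sum_univ_two, PiLp.inner_apply, rot_apply, hc,
          Real.norm_eq_abs, sq_abs]
        simp
        field_simp
        ring
  simp_rw [h1]
  rw [integral_const_mul, integral_cexp_neg_sq_add _ _ c, h0, f00_apply_norm hθ]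
  · simp; field_simp; ring
  · norm_cast; positivity

theorem integral_f00 {θ : ℝ} (hθ : 0 < θ) : ∫ x, f00 θ x = ((2 * Real.pi * θ : ℝ) : ℂ) := by
  have h := fourier_f00 hθ 0
  rw [fourier_apply_phase] at h
  simpa using h

/-! ### Series, completeness and translations of Schwartz functions -/

/-- A tempered distribution is bounded by a finite sum of Schwartz seminorms. -/
theorem exists_seminorm_bound (a : 𝓢'(Plane, ℂ)) :
    ∃ (s : Finset (ℕ × ℕ)) (C : ℝ), 0 ≤ C ∧
      ∀ f, ‖a f‖ ≤ C * ∑ i ∈ s, SchwartzMap.seminorm ℂ i.1 i.2 f := by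
  obtain ⟨s, C, -, h⟩ := Seminorm.bound_of_continuous (schwartz_withSeminorms ℂ Plane ℂ)
    ((normSeminorm ℂ ℂ).comp (a : 𝓢(Plane, ℂ) →L[ℂ] ℂ).toLinearMap)
    (continuous_norm.comp a.continuous)
  refine ⟨s, C, C.2, fun f => (h f).trans (mul_le_mul_of_nonneg_left ?_ C.2)⟩
  exact Seminorm.finset_sup_apply_le (Finset.sum_nonneg fun _ _ => apply_nonneg _ _)
    fun i hi => Finset.single_le_sum (f := fun i : ℕ × ℕ => SchwartzMap.seminorm ℂ i.1 i.2 f)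
      (fun _ _ => apply_nonneg _ _) hi

section Series

variable {E F : Type*} [NormedAddCommGroup E] [NormedSpace ℝ E] [NormedAddCommGroup F]
  [NormedSpace ℝ F]

/-- A series of Schwartz functions with `∑ p (u i) < ∞` for all Schwartz seminorms `p` converges in
the Schwartz space. -/
theorem summable_of_summable_seminorm [CompleteSpace F] {ι : Type*} {u : ι → 𝓢(E, F)}
    (h : ∀ k n, Summable fun i => SchwartzMap.seminorm ℝ k n (u i)) : Summable u := by
  have hs (n : ℕ) (i : ι) (x : E) :
      ‖iteratedFDeriv ℝ n (u i) x‖ ≤ SchwartzMap.seminorm ℝ 0 n (u i) :=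
    (u i).norm_iteratedFDeriv_le_seminorm ℝ n x
  have hder (s : Finset ι) (n : ℕ) : iteratedFDeriv ℝ n (fun y => ∑' i : {i // i ∉ s}, u i y) =
      fun x => ∑' i : {i // i ∉ s}, iteratedFDeriv ℝ n (u i) x :=
    iteratedFDeriv_tsum (N := ⊤) (v := fun n (i : {i // i ∉ s}) => SchwartzMap.seminorm ℝ 0 n (u i))
      (fun i => (u i).smooth ⊤) (fun n _ => (h 0 n).subtype _) (fun n i x _ => hs n i x)
      (mod_cast le_top)
  have hbound (s : Finset ι) (k n : ℕ) (x : E) :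
      ‖x‖ ^ k * ‖iteratedFDeriv ℝ n (fun y => ∑' i : {i // i ∉ s}, u i y) x‖ ≤
        ∑' i : {i // i ∉ s}, SchwartzMap.seminorm ℝ k n (u i) := by
    have h1 : Summable fun i : {i // i ∉ s} => ‖iteratedFDeriv ℝ n (u i) x‖ :=
      .of_nonneg_of_le (fun _ => norm_nonneg _) (fun i => hs n i x) ((h 0 n).subtype _)
    rw [hder]
    calc _ ≤ ‖x‖ ^ k * ∑' i : {i // i ∉ s}, ‖iteratedFDeriv ℝ n (u i) x‖ := by
          gcongr; exact norm_tsum_le_tsum_norm h1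
      _ = ∑' i : {i // i ∉ s}, ‖x‖ ^ k * ‖iteratedFDeriv ℝ n (u i) x‖ := tsum_mul_left.symm
      _ ≤ _ := (h1.mul_left _).tsum_le_tsum (fun i => (u i).le_seminorm ℝ k n x)
          ((h k n).subtype _)
  have hsum (x : E) : Summable fun i => u i x :=
    .of_norm (.of_nonneg_of_le (fun _ => norm_nonneg _)
      (fun i => (u i).norm_le_seminorm ℝ x) (h 0 0))
  let f : 𝓢(E, F) :=
    { toFun := fun x => ∑' i, u i x
      smooth' := contDiff_tsum (N := ⊤) (v := fun n i => SchwartzMap.seminorm ℝ 0 n (u i))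
        (fun i => (u i).smooth ⊤) (fun n _ => h 0 n) (fun n i x _ => hs n i x)
      decay' := fun k n => ⟨_, fun x => by
        have h1 : (fun y => ∑' i, u i y) = fun y => ∑' i : {i // i ∉ (∅ : Finset ι)}, u i y := by
          funext y
          have := (hsum y).sum_add_tsum_subtype_compl ∅
          simpa using this.symm
        rw [h1]
        exact hbound ∅ k n x⟩ }
  refine ⟨f, (schwartz_withSeminorms ℝ E F).tendsto_nhds _ _ |>.2 fun ⟨k, n⟩ ε hε => ?_⟩
  filter_upwards [(tendsto_tsum_compl_atTop_zero fun i =>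
    SchwartzMap.seminorm ℝ k n (u i)).eventually_lt_const hε] with s hs'
  refine lt_of_le_of_lt ?_ hs'
  rw [← map_sub_rev]
  refine SchwartzMap.seminorm_le_bound ℝ k n _ (tsum_nonneg fun _ => apply_nonneg _ _)
    fun x => ?_
  have h2 : (f - ∑ i ∈ s, u i : 𝓢(E, F)) = fun y => ∑' i : {i // i ∉ s}, u i y := by
    funext y
    rw [sub_apply, sub_eq_iff_eq_add']
    have := (hsum y).sum_add_tsum_subtype_compl s
    simpa using (show f y = ∑' i, u i y from rfl).trans this.symm
  rw [h2]
  exact hbound s k n x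

/-- The space of Schwartz functions is complete: a sequence which is Cauchy sufficiently fast is the
sequence of partial sums of a series as in `summable_of_summable_seminorm`. -/
theorem completeSpace_schwartz [CompleteSpace F] : CompleteSpace 𝓢(E, F) := by
  have : (uniformity 𝓢(E, F)).IsCountablyGenerated :=
    IsUniformAddGroup.uniformity_countably_generated
  set p := schwartzSeminormFamily ℝ E F
  have hp := schwartz_withSeminorms ℝ E F
  let V (N : ℕ) : Set 𝓢(E, F) := (((Finset.range N ×ˢ Finset.range N).sup p).ball 0 ((1 / 2) ^ N))
  have hV (N : ℕ) : V N ∈ nhds (0 : 𝓢(E, F)) :=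
    hp.mem_nhds_iff _ _ |>.2 ⟨_, _, by positivity, subset_rfl⟩
  refine UniformSpace.complete_of_convergent_controlled_sequences
    (fun N => {q | q.2 - q.1 ∈ V N}) (fun N => ?_) fun u hu => ?_
  · rw [uniformity_eq_comap_nhds_zero]
    exact ⟨V N, hV N, fun q hq => hq⟩
  · have h1 : Summable fun i => u (i + 1) - u i := by
      refine summable_of_summable_seminorm fun k n => ?_
      refine Summable.of_norm_bounded_eventually_nat (g := fun N : ℕ => (1 / 2 : ℝ) ^ N)
        (summable_geometric_of_lt_one (by norm_num) (by norm_num)) ?_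
      filter_upwards [Filter.eventually_gt_atTop (max k n)] with N hN
      have h2 : u (N + 1) - u N ∈ V N := hu N N (N + 1) le_rfl (Nat.le_succ N)
      rw [Seminorm.mem_ball, sub_zero] at h2
      rw [Real.norm_of_nonneg (apply_nonneg _ _)]
      refine le_trans ?_ h2.le
      exact Seminorm.le_finset_sup_apply (p := p) (i := (k, n))
        (by simp; omega)
    obtain ⟨f, hf⟩ := h1
    refine ⟨f + u 0, ?_⟩
    have h3 := hf.tendsto_sum_nat.add_const (u 0)
    simpa only [Finset.sum_range_sub, sub_add_cancel] using h3

end Series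

section Translation

-- The codomains are in a fixed universe, as the induction on the number of derivatives replaces
-- `F` by `Plane →L[ℝ] F`.
variable {F : Type} [NormedAddCommGroup F] [NormedSpace ℝ F]

theorem pow_norm_le_translate (k : ℕ) {v x : Plane} {t : ℝ} (ht : |t| ≤ 1) :
    ‖x‖ ^ k ≤ (1 + ‖v‖) ^ k * (1 + ‖x - t • v‖) ^ k := by
  rw [← mul_pow]
  gcongr
  have h1 : ‖x‖ ≤ ‖x - t • v‖ + ‖t • v‖ := by simpa using norm_add_le (x - t • v) (t • v)
  have h2 : ‖t • v‖ ≤ ‖v‖ := by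
    rw [norm_smul, Real.norm_eq_abs]; exact mul_le_of_le_one_left (norm_nonneg v) ht
  nlinarith [norm_nonneg v, norm_nonneg (x - t • v)]

theorem hasDerivAt_translate (f : 𝓢(Plane, F)) (v x : Plane) (t : ℝ) :
    HasDerivAt (fun s : ℝ => f (x - s • v)) (-(∂_{v} f) (x - t • v)) t := by
  have h1 : HasDerivAt (fun s : ℝ => x - s • v) (-v) t := by
    simpa using ((hasDerivAt_id t).smul_const v).const_sub x
  have h2 := (f.hasFDerivAt (x - t • v)).comp_hasDerivAt t h1
  rwa [map_neg, ← lineDerivOp_apply_eq_fderiv] at h2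

theorem translate_sub_le (f : 𝓢(Plane, F)) (v : Plane) (k : ℕ) :
    ∃ C, 0 ≤ C ∧ ∀ (t : ℝ), |t| ≤ 1 → ∀ x, ‖x‖ ^ k * ‖f (x - t • v) - f x‖ ≤ C * |t| := by
  set B := 2 ^ k * ((Finset.Iic (k, 0)).sup (schwartzSeminormFamily ℝ Plane F)) (∂_{v} f)
  refine ⟨(1 + ‖v‖) ^ k * B, by positivity, fun t ht x => ?_⟩
  have h1 := Convex.norm_image_sub_le_of_norm_hasDerivWithin_le (𝕜 := ℝ)
    (f := fun s : ℝ => ‖x‖ ^ k • f (x - s • v)) (s := Set.Icc (-|t|) |t|)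
    (f' := fun s => ‖x‖ ^ k • (-(∂_{v} f) (x - s • v))) (C := (1 + ‖v‖) ^ k * B)
    (x := 0) (y := t)
    (fun s _ => ((hasDerivAt_translate f v x s).const_smul _).hasDerivWithinAt)
    (fun s hs => ?_) (convex_Icc _ _) (by simp) ⟨neg_abs_le t, le_abs_self t⟩
  · simpa [← smul_sub, norm_smul] using h1
  · have h2 := one_add_le_sup_seminorm_apply (𝕜 := ℝ) (m := (k, 0)) le_rfl le_rfl (∂_{v} f)
      (x - s • v)
    rw [norm_smul, norm_neg, norm_pow, norm_norm]
    rw [norm_iteratedFDeriv_zero] at h2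
    calc _ ≤ ((1 + ‖v‖) ^ k * (1 + ‖x - s • v‖) ^ k) * ‖(∂_{v} f) (x - s • v)‖ := by
          gcongr; exact pow_norm_le_translate k ((abs_le.2 hs).trans ht)
      _ ≤ _ := by rw [mul_assoc]; gcongr; exact h2

theorem translate_taylor_le (f : 𝓢(Plane, F)) (v : Plane) (k : ℕ) :
    ∃ C, 0 ≤ C ∧ ∀ (t : ℝ), |t| ≤ 1 → ∀ x,
      ‖x‖ ^ k * ‖f (x - t • v) - f x + t • (∂_{v} f) x‖ ≤ C * |t| ^ 2 := by
  obtain ⟨C, hC, h⟩ := translate_sub_le (∂_{v} f) v k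
  refine ⟨C, hC, fun t ht x => ?_⟩
  have h1 := Convex.norm_image_sub_le_of_norm_hasDerivWithin_le (𝕜 := ℝ)
    (f := fun s : ℝ => ‖x‖ ^ k • (f (x - s • v) + s • (∂_{v} f) x)) (s := Set.Icc (-|t|) |t|)
    (f' := fun s => ‖x‖ ^ k • (-(∂_{v} f) (x - s • v) + (∂_{v} f) x)) (C := C * |t|)
    (x := 0) (y := t)
    (fun s _ => (((hasDerivAt_translate f v x s).add
      (by simpa using (hasDerivAt_id s).smul_const ((∂_{v} f) x))).const_smul
        _).hasDerivWithinAt)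
    (fun s hs => ?_) (convex_Icc _ _) (by simp) ⟨neg_abs_le t, le_abs_self t⟩
  · rw [← smul_sub, norm_smul, norm_pow, norm_norm] at h1
    simp only [zero_smul, sub_zero, add_zero, Real.norm_eq_abs] at h1
    rw [sq, ← mul_assoc]
    refine le_trans (le_of_eq ?_) h1
    congr 2; abel
  · have h2 := h s ((abs_le.2 hs).trans ht) x
    rw [norm_smul, norm_pow, norm_norm, neg_add_eq_sub, norm_sub_rev]
    exact h2.trans (mul_le_mul_of_nonneg_left (abs_le.2 hs) hC)

theorem fderivCLM_lineDeriv (f : 𝓢(Plane, F)) (v : Plane) :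
    fderivCLM ℝ Plane F (∂_{v} f) = ∂_{v} (fderivCLM ℝ Plane F f) := by
  ext x w
  have h1 : ((∂_{v} f : 𝓢(Plane, F)) : Plane → F) = fun y => fderivCLM ℝ Plane F f y v := by
    funext y; rw [lineDerivOp_apply_eq_fderiv]; rfl
  have h2 : (fderivCLM ℝ Plane F f : Plane → _) = fderiv ℝ f := rfl
  rw [fderivCLM_apply, h1, lineDerivOp_apply_eq_fderiv,
    (((fderivCLM ℝ Plane F f).hasFDerivAt x).clm_apply (hasFDerivAt_const v x)).fderiv]
  have h3 : IsSymmSndFDerivAt ℝ f x :=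
    (f.contDiffAt 2).isSymmSndFDerivAt (by simp)
  simp [h2, h3.eq w v]

/-- Translations are differentiable in the Schwartz space, with a quadratic remainder. The induction
on `n` uses that translations and `∂_v` commute with the Fréchet derivative. -/
theorem seminorm_translate_taylor_le (n k : ℕ) (v : Plane) : ∀ {F : Type}
    [NormedAddCommGroup F] [NormedSpace ℝ F] (f : 𝓢(Plane, F)),
    ∃ C, 0 ≤ C ∧ ∀ (t : ℝ), |t| ≤ 1 → SchwartzMap.seminorm ℝ k n
      (compSubConstCLM ℝ (t • v) f - f + t • (∂_{v} f)) ≤ C * |t| ^ 2 := by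
  induction n with
  | zero =>
    intro F _ _ f
    obtain ⟨C, hC, h⟩ := translate_taylor_le f v k
    refine ⟨C, hC, fun t ht => SchwartzMap.seminorm_le_bound ℝ k 0 _ (by positivity) fun x => ?_⟩
    rw [norm_iteratedFDeriv_zero]
    exact h t ht x
  | succ n ih =>
    intro F _ _ f
    obtain ⟨C, hC, h⟩ := ih (fderivCLM ℝ Plane F f)
    refine ⟨C, hC, fun t ht => SchwartzMap.seminorm_le_bound ℝ k _ _ (by positivity) fun x => ?_⟩
    have h1 : fderivCLM ℝ Plane F (compSubConstCLM ℝ (t • v) f - f + t • (∂_{v} f)) =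
        compSubConstCLM ℝ (t • v) (fderivCLM ℝ Plane F f) - fderivCLM ℝ Plane F f +
          t • (∂_{v} (fderivCLM ℝ Plane F f)) := by
      rw [map_add, map_sub, map_smul, fderivCLM_lineDeriv]
      congr 2
      ext1 y
      rw [fderivCLM_apply, compSubConstCLM_apply, fderivCLM_apply]
      exact fderiv_comp_sub (f := f) (t • v)
    have h2 := (SchwartzMap.le_seminorm ℝ k n _ x).trans (h1 ▸ h t ht)
    rwa [show (fderivCLM ℝ Plane F (compSubConstCLM ℝ (t • v) f - f + t • (∂_{v} f)) :
      Plane → _) = fderiv ℝ _ from rfl, norm_iteratedFDeriv_fderiv] at h2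

end Translation

/-- A tempered distribution can be differentiated along a translation of its argument. -/
theorem hasDerivAt_apply_translate (a : 𝓢'(Plane, ℂ)) (f : 𝓢(Plane, ℂ)) (v : Plane) (t : ℝ) :
    HasDerivAt (fun s : ℝ => a (compSubConstCLM ℂ (s • v) f))
      (-a (∂_{v} (compSubConstCLM ℂ (t • v) f))) t := by
  obtain ⟨s, C, hC, ha⟩ := exists_seminorm_bound a
  set g := compSubConstCLM ℂ (t • v) f with hg
  choose B hB0 hB using fun i : ℕ × ℕ => seminorm_translate_taylor_le i.2 i.1 v g
  have htr (h : ℝ) : compSubConstCLM ℂ ((t + h) • v) f = compSubConstCLM ℂ (h • v) g := by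
    ext x
    simp only [hg, compSubConstCLM_apply, add_smul]
    congr 1; abel
  rw [hasDerivAt_iff_isLittleO_nhds_zero]
  refine Asymptotics.IsBigO.trans_isLittleO (g := fun h : ℝ => h ^ 2) ?_ ?_
  · refine Asymptotics.IsBigO.of_bound (C * ∑ i ∈ s, B i) ?_
    filter_upwards [Metric.ball_mem_nhds (0 : ℝ) one_pos] with h hh
    have hh' : |h| ≤ 1 := by simpa using (mem_ball_zero_iff.1 hh).le
    have h1 : a (compSubConstCLM ℂ ((t + h) • v) f) - a (compSubConstCLM ℂ (t • v) f) -
        h • -a (∂_{v} g) = a (compSubConstCLM ℂ (h • v) g - g + (h : ℂ) • ∂_{v} g) := by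
      rw [htr, map_add, map_sub, map_smul, ← hg, smul_neg, sub_neg_eq_add]; rfl
    rw [h1]
    refine (ha _).trans ?_
    rw [mul_assoc, Finset.sum_mul]
    gcongr with i hi
    rw [norm_pow, Real.norm_eq_abs]
    exact hB i h hh'
  · simpa using Asymptotics.isLittleO_pow_id (𝕜 := ℝ) (n := 2) (by norm_num)

/-! ### The multiplier algebra -/

theorem moyal_add_left {θ : ℝ} (hθ : θ ≠ 0) (f f' g : 𝓢(Plane, ℂ)) :
    moyal θ (f + f') g = moyal θ f g + moyal θ f' g :=
  eq_of_pair_eq fun u => by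
    rw [pair_add_left, pair_moyal hθ, pair_moyal hθ, pair_moyal hθ, pair_add_left]

theorem moyal_smul_left {θ : ℝ} (hθ : θ ≠ 0) (c : ℂ) (f g : 𝓢(Plane, ℂ)) :
    moyal θ (c • f) g = c • moyal θ f g :=
  eq_of_pair_eq fun u => by
    rw [pair_smul_left, pair_moyal hθ, pair_moyal hθ, pair_smul_left]

/-- Left multiplication with a multiplier, as a linear map. -/
def leftMulLM {θ : ℝ} (hθ : θ ≠ 0) {a : 𝓢'(Plane, ℂ)} (ha : IsMultiplier θ a) :
    𝓢(Plane, ℂ) →ₗ[ℂ] 𝓢(Plane, ℂ) where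
  toFun := leftMul θ a
  map_add' f g := eq_of_pair_eq fun u => by
    rw [pair_add_left, ← leftMul_spec ha, ← leftMul_spec ha, ← leftMul_spec ha,
      moyal_add_left hθ, map_add]
  map_smul' c f := eq_of_pair_eq fun u => by
    rw [RingHom.id_apply, pair_smul_left, ← leftMul_spec ha, ← leftMul_spec ha,
      moyal_smul_left hθ, map_smul, smul_eq_mul]

theorem continuous_pair_left (g : 𝓢(Plane, ℂ)) : Continuous fun f => pair f g := by
  have h : (fun f => pair f g) = fun f => SchwartzMap.toTemperedDistributionCLM Plane ℂ volume g f := by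
    funext f
    rw [SchwartzMap.toTemperedDistributionCLM_apply_apply (μ := volume)]; rfl
  rw [h]
  exact ContinuousLinearMap.continuous _

/-- A multiplier has a transpose: `⟨a ⋆ b, g⟩ = ⟨g ⋆ a, b⟩`, so `b ↦ ⟨a ⋆ b, g⟩` is continuous. -/
theorem pair_leftMul {θ : ℝ} {a : 𝓢'(Plane, ℂ)} (ha : IsMultiplier θ a) (b g : 𝓢(Plane, ℂ)) :
    pair (leftMul θ a b) g = pair b (rightMul θ a g) := by
  rw [← leftMul_spec ha, rightMul_spec ha, pair_comm]

theorem norm_pair_le {u : 𝓢(Plane, ℂ)} {C : ℝ} (h : ∀ x, ‖u x‖ ≤ C) (g : 𝓢(Plane, ℂ)) :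
    ‖pair u g‖ ≤ C * ∫ x, ‖g x‖ := by
  rw [pair, ← integral_const_mul]
  refine norm_integral_le_of_norm_le (g.integrable.norm.const_mul C)
    (Filter.Eventually.of_forall fun x => ?_)
  rw [norm_mul]
  gcongr
  exact h x

/-- The supremum norm of a Schwartz function is its norm as a functional for the `L¹` norm. -/
theorem norm_le_of_norm_pair_le {u : 𝓢(Plane, ℂ)} {C : ℝ} (hC : 0 ≤ C)
    (h : ∀ g, ‖pair u g‖ ≤ C * ∫ x, ‖g x‖) (x₀ : Plane) : ‖u x₀‖ ≤ C := by
  by_contra! hlt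
  have hu0 : 0 < ‖u x₀‖ := hC.trans_lt hlt
  have hcont : Continuous fun x => (conj (u x₀) * u x).re := by fun_prop
  have hx₀ : C * ‖u x₀‖ < (conj (u x₀) * u x₀).re := by
    rw [Complex.conj_mul', ← Complex.ofReal_pow, Complex.ofReal_re, sq]
    gcongr
  obtain ⟨δ, hδ, hball⟩ := Metric.isOpen_iff.1 (isOpen_lt continuous_const hcont) x₀ hx₀
  let φ : ContDiffBump x₀ := ⟨δ / 2, δ, by positivity, by linarith⟩
  let g : 𝓢(Plane, ℂ) := HasCompactSupport.toSchwartzMap (f := fun x => conj (u x₀) * (φ x : ℂ))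
    ((φ.hasCompactSupport.comp_left (g := fun r : ℝ => (r : ℂ)) rfl).mul_left)
    (contDiff_const.mul (Complex.ofRealCLM.contDiff.comp φ.contDiff))
  have hg (x : Plane) : g x = conj (u x₀) * (φ x : ℂ) := rfl
  have hgn (x : Plane) : ‖g x‖ = ‖u x₀‖ * φ x := by
    rw [hg, norm_mul, RCLike.norm_conj, Complex.norm_real, Real.norm_of_nonneg φ.nonneg]
  have h1 : ∫ x, (u x * g x).re ≤ ∫ x, C * ‖g x‖ := by
    rw [integral_const_mul]
    refine le_trans ?_ (h g)
    have h2 := integral_re (𝕜 := ℂ) (integrable_mul u g)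
    refine (le_of_eq ?_).trans (Complex.re_le_norm _)
    exact h2
  have hre (x : Plane) : (u x * g x).re = φ x * (conj (u x₀) * u x).re := by
    rw [hg, show u x * (conj (u x₀) * (φ x : ℂ)) = (φ x : ℂ) * (conj (u x₀) * u x) by ring,
      Complex.re_ofReal_mul]
  have hnn (x : Plane) : 0 ≤ (u x * g x).re - C * ‖g x‖ := by
    rw [hre, hgn]
    by_cases hx : x ∈ Metric.ball x₀ δ
    · have := hball hx
      have h3 : C * ‖u x₀‖ < (conj (u x₀) * u x).re := this
      nlinarith [φ.nonneg (x := x)]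
    · rw [φ.zero_of_le_dist (by simpa using hx)]; simp
  have hi1 : Integrable fun x => (u x * g x).re := (integrable_mul u g).re
  have hi2 : Integrable fun x => C * ‖g x‖ := g.integrable.norm.const_mul C
  have h4 : ∫ x, ((u x * g x).re - C * ‖g x‖) = 0 := by
    refine le_antisymm ?_ (integral_nonneg hnn)
    rw [integral_sub hi1 hi2]; linarith
  rw [integral_eq_zero_iff_of_nonneg hnn (hi1.sub hi2)] at h4
  have h5 : (fun x => (u x * g x).re - C * ‖g x‖) = 0 :=
    (Continuous.ae_eq_iff_eq volume (by fun_prop) continuous_const).1 h4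
  have h6 := congrFun h5 x₀
  simp only [hre, hgn, Pi.zero_apply] at h6
  rw [φ.one_of_mem_closedBall (Metric.mem_closedBall_self (by positivity))] at h6
  linarith

/-- Iterated derivatives have a transpose. -/
theorem exists_pair_iteratedLineDeriv {n : ℕ} (m : Fin n → Plane) (g : 𝓢(Plane, ℂ)) :
    ∃ g' : 𝓢(Plane, ℂ), ∀ h : 𝓢(Plane, ℂ), pair (∂^{m} h) g = pair h g' := by
  induction n generalizing g with
  | zero => exact ⟨g, fun h => rfl⟩
  | succ n ih =>
    obtain ⟨g', hg'⟩ := ih (Fin.tail m) (-∂_{m 0} g)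
    refine ⟨g', fun h => ?_⟩
    rw [iteratedLineDerivOp_succ_left, pair_lineDeriv_left, ← hg', pair, pair, ← integral_neg]
    congr 1; funext x
    rw [neg_apply, mul_neg]

/-- The weighted derivative `x ↦ ‖x‖ ^ (2 k) ∂^m h`. -/
def weightedDeriv (k : ℕ) {n : ℕ} (m : Fin n → Plane) (h : 𝓢(Plane, ℂ)) : 𝓢(Plane, ℂ) :=
  smulLeftCLM ℂ (fun x : Plane => ((‖x‖ ^ 2 : ℝ) : ℂ) ^ k) (∂^{m} h)

theorem normSq_pow_hasTemperateGrowth (k : ℕ) :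
    (fun x : Plane => ((‖x‖ ^ 2 : ℝ) : ℂ) ^ k).HasTemperateGrowth := by
  have h1 : (fun x : Plane => ((‖x‖ ^ 2 : ℝ) : ℂ)).HasTemperateGrowth :=
    Complex.ofRealCLM.hasTemperateGrowth.comp (Function.hasTemperateGrowth_norm_sq (H := Plane))
  induction k with
  | zero => simpa only [pow_zero] using Function.HasTemperateGrowth.const (1 : ℂ)
  | succ k ih =>
    simp only [pow_succ _ k]
    exact ih.mul h1

theorem weightedDeriv_apply (k : ℕ) {n : ℕ} (m : Fin n → Plane) (h : 𝓢(Plane, ℂ)) (x : Plane) :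
    weightedDeriv k m h x = ((‖x‖ ^ 2 : ℝ) : ℂ) ^ k * iteratedFDeriv ℝ n h x m := by
  rw [weightedDeriv, smulLeftCLM_apply_apply (normSq_pow_hasTemperateGrowth k),
    iteratedLineDerivOp_eq_iteratedFDeriv, smul_eq_mul]

theorem exists_pair_weightedDeriv (k : ℕ) {n : ℕ} (m : Fin n → Plane) (g : 𝓢(Plane, ℂ)) :
    ∃ g' : 𝓢(Plane, ℂ), ∀ h : 𝓢(Plane, ℂ), pair (weightedDeriv k m h) g = pair h g' := by
  obtain ⟨g', hg'⟩ := exists_pair_iteratedLineDeriv m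
    (smulLeftCLM ℂ (fun x : Plane => ((‖x‖ ^ 2 : ℝ) : ℂ) ^ k) g)
  refine ⟨g', fun h => ?_⟩
  rw [← hg', pair, pair, weightedDeriv]
  congr 1; funext x
  rw [smulLeftCLM_apply_apply (normSq_pow_hasTemperateGrowth k),
    smulLeftCLM_apply_apply (normSq_pow_hasTemperateGrowth k), smul_eq_mul, smul_eq_mul]
  ring

theorem norm_weightedDeriv_le (k : ℕ) {n : ℕ} (m : Fin n → Plane) (h : 𝓢(Plane, ℂ)) (x : Plane) :
    ‖weightedDeriv k m h x‖ ≤ SchwartzMap.seminorm ℂ (2 * k) n h * ∏ i, ‖m i‖ := by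
  rw [weightedDeriv_apply, norm_mul, norm_pow, Complex.norm_real, norm_pow, norm_norm, ← pow_mul]
  calc _ ≤ ‖x‖ ^ (2 * k) * (‖iteratedFDeriv ℝ n h x‖ * ∏ i, ‖m i‖) := by
        gcongr; exact ContinuousMultilinearMap.le_opNorm _ _
    _ ≤ _ := by
        rw [← mul_assoc]
        gcongr
        exact h.le_seminorm ℂ (2 * k) n x

/-- A ball of a Schwartz seminorm with even weight is cut out by conditions on pairings with
Schwartz functions. -/
theorem seminorm_le_iff_pair (k n : ℕ) {r : ℝ} (hr : 0 ≤ r) (h : 𝓢(Plane, ℂ)) :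
    SchwartzMap.seminorm ℂ (2 * k) n h ≤ r ↔ ∀ (m : Fin n → Plane) (g : 𝓢(Plane, ℂ)),
      ‖pair (weightedDeriv k m h) g‖ ≤ r * (∏ i, ‖m i‖) * ∫ x, ‖g x‖ := by
  constructor
  · intro hle m g
    refine norm_pair_le (fun x => (norm_weightedDeriv_le k m h x).trans ?_) g
    gcongr
  · intro hle
    refine SchwartzMap.seminorm_le_bound ℂ _ n h hr fun x => ?_
    have h1 : ‖x‖ ^ (2 * k) * ‖iteratedFDeriv ℝ n h x‖ =
        ‖(‖x‖ ^ (2 * k)) • iteratedFDeriv ℝ n h x‖ := by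
      rw [norm_smul, norm_pow, norm_norm]
    rw [h1]
    refine ContinuousMultilinearMap.opNorm_le_bound hr fun m => ?_
    have h2 := norm_le_of_norm_pair_le (by positivity) (hle m) x
    rw [weightedDeriv_apply] at h2
    rw [smul_apply, norm_smul]
    simpa [pow_mul] using h2

/-- Left multiplication with a multiplier is continuous: the seminorms of `a ⋆ b` are lower
semicontinuous in `b`, because `a ⋆ b` depends continuously on `b` in the sense of distributions,
and a Fréchet space is barrelled. -/
theorem continuous_leftMul {θ : ℝ} (hθ : θ ≠ 0) {a : 𝓢'(Plane, ℂ)} (ha : IsMultiplier θ a) :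
    Continuous (leftMul θ a) := by
  have : CompleteSpace 𝓢(Plane, ℂ) := completeSpace_schwartz
  have : (uniformity 𝓢(Plane, ℂ)).IsCountablyGenerated :=
    IsUniformAddGroup.uniformity_countably_generated
  have heven (k n : ℕ) :
      Continuous ((SchwartzMap.seminorm ℂ (2 * k) n).comp (leftMulLM hθ ha)) := by
    refine Seminorm.continuous_of_lowerSemicontinuous _
      (lowerSemicontinuous_iff_isClosed_preimage.2 fun r => ?_)
    rcases lt_or_ge r 0 with hr | hr
    · convert isClosed_empty
      ext b
      simp only [Set.mem_preimage, Set.mem_Iic, Set.mem_empty_iff_false, iff_false, not_le]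
      exact hr.trans_le (apply_nonneg _ _)
    · have hset : (⇑((SchwartzMap.seminorm ℂ (2 * k) n).comp (leftMulLM hθ ha)) ⁻¹' Set.Iic r) =
          ⋂ (m : Fin n → Plane) (g : 𝓢(Plane, ℂ)), {b | ‖pair (weightedDeriv k m (leftMul θ a b)) g‖
            ≤ r * (∏ i, ‖m i‖) * ∫ x, ‖g x‖} := by
        ext b
        simp only [Set.mem_preimage, Set.mem_Iic, Set.mem_iInter, Set.mem_ofPred_eq]
        exact seminorm_le_iff_pair k n hr _
      rw [hset]
      refine isClosed_iInter fun m => isClosed_iInter fun g => ?_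
      obtain ⟨g', hg'⟩ := exists_pair_weightedDeriv k m g
      simp only [hg', pair_leftMul ha]
      exact isClosed_le (continuous_pair_left _).norm continuous_const
  refine (schwartz_withSeminorms ℂ Plane ℂ).continuous_of_continuous_comp (leftMulLM hθ ha)
    fun ⟨k, n⟩ => ?_
  -- odd weights: `‖x‖ ^ k ≤ 1 + ‖x‖ ^ (2 * k)`
  have hadd : Continuous ((SchwartzMap.seminorm ℂ (2 * 0) n).comp (leftMulLM hθ ha) +
      (SchwartzMap.seminorm ℂ (2 * k) n).comp (leftMulLM hθ ha)) := (heven 0 n).add (heven k n)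
  refine Seminorm.continuous_of_le hadd fun b => ?_
  refine SchwartzMap.seminorm_le_bound ℂ k n _
    (add_nonneg (apply_nonneg _ _) (apply_nonneg _ _)) fun x => ?_
  set h := leftMulLM hθ ha b
  have h0 := h.le_seminorm ℂ (2 * 0) n x
  have h1 := h.le_seminorm ℂ (2 * k) n x
  refine le_trans ?_ (add_le_add h0 h1)
  rw [← add_mul]
  gcongr
  rw [mul_zero, pow_zero, mul_comm, pow_mul]
  nlinarith [sq_nonneg (‖x‖ ^ k - 1), sq_nonneg (‖x‖ ^ k)]

/-- The product of a distribution with a multiplier is the distribution of the defining formula, and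
not a default value. -/
theorem mulDist_apply {θ : ℝ} (hθ : θ ≠ 0) (a : 𝓢'(Plane, ℂ)) {c : 𝓢'(Plane, ℂ)}
    (hc : IsMultiplier θ c) (b : 𝓢(Plane, ℂ)) : mulDist θ a c b = a (leftMul θ c b) := by
  have h : ∃ d : 𝓢'(Plane, ℂ), ∀ b, d b = a (leftMul θ c b) :=
    ⟨ContinuousLinearMap.toPointwiseConvergenceCLM ℂ (RingHom.id ℂ) 𝓢(Plane, ℂ) ℂ
      ((a : 𝓢(Plane, ℂ) →L[ℂ] ℂ) ∘L ⟨leftMulLM hθ hc, continuous_leftMul hθ hc⟩), fun b => rfl⟩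
  rw [mulDist, dif_pos h]
  exact h.choose_spec b

theorem leftMul_moyal {θ : ℝ} (hθ : θ ≠ 0) {a : 𝓢'(Plane, ℂ)} (ha : IsMultiplier θ a)
    (b g : 𝓢(Plane, ℂ)) : leftMul θ a (moyal θ b g) = moyal θ (leftMul θ a b) g :=
  eq_of_pair_eq fun u => by
    rw [← leftMul_spec ha, moyal_assoc hθ, leftMul_spec ha, pair_moyal hθ]

theorem isMultiplier_mulDist {θ : ℝ} (hθ : θ ≠ 0) {a c : 𝓢'(Plane, ℂ)} (ha : IsMultiplier θ a)
    (hc : IsMultiplier θ c) : IsMultiplier θ (mulDist θ a c) := by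
  refine fun b => ⟨⟨leftMul θ a (leftMul θ c b), fun g => ?_⟩,
    ⟨rightMul θ c (rightMul θ a b), fun g => ?_⟩⟩
  · rw [mulDist_apply hθ a hc, leftMul_moyal hθ hc, leftMul_spec ha]; rfl
  · rw [mulDist_apply hθ a hc, leftMul_moyal hθ hc, rightMul_spec ha, pair_comm,
      pair_leftMul hc, pair_comm]; rfl

theorem IsLeftMul.adj {θ : ℝ} (hθ : θ ≠ 0) {a : 𝓢'(Plane, ℂ)} {b c : 𝓢(Plane, ℂ)}
    (h : IsRightMul θ a (conjS b) c) : IsLeftMul θ (adj a) b (conjS c) := by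
  intro g
  rw [adj_apply, conjS_moyal hθ, h, ← integral_conj]
  simp [conjS_apply]

theorem IsRightMul.adj {θ : ℝ} (hθ : θ ≠ 0) {a : 𝓢'(Plane, ℂ)} {b c : 𝓢(Plane, ℂ)}
    (h : IsLeftMul θ a (conjS b) c) : IsRightMul θ (adj a) b (conjS c) := by
  intro g
  rw [adj_apply, conjS_moyal hθ, h, ← integral_conj]
  simp [conjS_apply]

theorem isMultiplier_adj {θ : ℝ} (hθ : θ ≠ 0) {a : 𝓢'(Plane, ℂ)} (ha : IsMultiplier θ a) :
    IsMultiplier θ (adj a) := fun b =>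
  ⟨(ha (conjS b)).2.imp' conjS fun _ h => IsLeftMul.adj hθ h,
    (ha (conjS b)).1.imp' conjS fun _ h => IsRightMul.adj hθ h⟩

theorem isLeftMul_zero (θ : ℝ) (b : 𝓢(Plane, ℂ)) : IsLeftMul θ 0 b 0 :=
  fun g => by simp

theorem isRightMul_zero (θ : ℝ) (b : 𝓢(Plane, ℂ)) : IsRightMul θ 0 b 0 :=
  fun g => by simp

/-- The multiplier algebra, as a subspace of the tempered distributions. -/
def multipliers (θ : ℝ) : Submodule ℂ 𝓢'(Plane, ℂ) where
  carrier := {a | IsMultiplier θ a}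
  add_mem' := fun ha hb f => by
    obtain ⟨⟨_, h1⟩, ⟨_, h2⟩⟩ := ha f
    obtain ⟨⟨_, h3⟩, ⟨_, h4⟩⟩ := hb f
    exact ⟨⟨_, h1.add h3⟩, ⟨_, h2.add h4⟩⟩
  zero_mem' := fun f => ⟨⟨_, isLeftMul_zero θ f⟩, ⟨_, isRightMul_zero θ f⟩⟩
  smul_mem' := fun k a ha f => by
    obtain ⟨⟨_, h1⟩, ⟨_, h2⟩⟩ := ha f
    exact ⟨⟨_, h1.smul k⟩, ⟨_, h2.smul k⟩⟩

theorem isStarSubalgebra_multipliers {θ : ℝ} (hθ : θ ≠ 0) :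
    IsStarSubalgebra θ (multipliers θ) where
  multiplier _ ha := ha
  adj_mem _ ha := isMultiplier_adj hθ ha
  mul_mem _ ha _ hc := isMultiplier_mulDist hθ ha hc

/-! ### The matrix basis in terms of monomials times the Gaussian -/

/-- Right multiplication with a multiplier, as a linear map. -/
def rightMulLM {θ : ℝ} {a : 𝓢'(Plane, ℂ)} (ha : IsMultiplier θ a) :
    𝓢(Plane, ℂ) →ₗ[ℂ] 𝓢(Plane, ℂ) where
  toFun := rightMul θ a
  map_add' f g := eq_of_pair_eq fun u => by
    rw [pair_add_left, pair_comm, pair_comm _ u, pair_comm _ u, ← pair_leftMul ha,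
      ← pair_leftMul ha, ← pair_leftMul ha, pair_comm, pair_comm _ f, pair_comm _ g,
      pair_add_left]
  map_smul' c f := eq_of_pair_eq fun u => by
    rw [RingHom.id_apply, pair_smul_left, pair_comm, pair_comm _ u, ← pair_leftMul ha,
      ← pair_leftMul ha, pair_comm, pair_comm _ f, pair_smul_left]

/-- The first vector of the standard basis of the plane, the direction of time. -/
def e₀ : Plane := EuclideanSpace.single 0 1

/-- The second vector of the standard basis of the plane, the direction of space. -/
def e₁ : Plane := EuclideanSpace.single 1 1

theorem rot_e₀ : rot e₀ = -e₁ := by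
  rw [rot_apply]; ext i; fin_cases i <;> simp [e₀, e₁]

theorem rot_e₁ : rot e₁ = e₀ := by
  rw [rot_apply]; ext i; fin_cases i <;> simp [e₀, e₁]

theorem sqrt_two_mul_self : (Real.sqrt 2 : ℂ) * (Real.sqrt 2 : ℂ) = 2 := by
  norm_cast; exact Real.mul_self_sqrt (by norm_num)

theorem sqrt_two_ne_zero : (Real.sqrt 2 : ℂ) ≠ 0 := by
  exact_mod_cast (Real.sqrt_pos.2 two_pos).ne'

theorem inner_e₀ (x : Plane) : ⟪e₀, x⟫ = x 0 := by
  simp [e₀, PiLp.inner_apply]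

theorem inner_e₁ (x : Plane) : ⟪e₁, x⟫ = x 1 := by
  simp [e₁, PiLp.inner_apply]

theorem zDist_eq :
    zDist = (Real.sqrt 2 : ℂ)⁻¹ • linDist e₀ + (Complex.I / Real.sqrt 2) • linDist e₁ := by
  ext f
  change (∫ x, f x • zFun x) = (Real.sqrt 2 : ℂ)⁻¹ * linDist e₀ f +
    (Complex.I / Real.sqrt 2) * linDist e₁ f
  rw [linDist_apply, linDist_apply, ← integral_const_mul, ← integral_const_mul,
    ← integral_add ((SchwartzMap.integrable _).const_mul _)
      ((SchwartzMap.integrable _).const_mul _)]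
  congr 1; funext x
  rw [mulLin_apply, mulLin_apply, inner_e₀, inner_e₁, zFun, smul_eq_mul]
  ring

theorem zbarDist_eq :
    zbarDist = (Real.sqrt 2 : ℂ)⁻¹ • linDist e₀ + (-Complex.I / Real.sqrt 2) • linDist e₁ := by
  ext f
  change (∫ x, f x • zbarFun x) = (Real.sqrt 2 : ℂ)⁻¹ * linDist e₀ f +
    (-Complex.I / Real.sqrt 2) * linDist e₁ f
  rw [linDist_apply, linDist_apply, ← integral_const_mul, ← integral_const_mul,
    ← integral_add ((SchwartzMap.integrable _).const_mul _)
      ((SchwartzMap.integrable _).const_mul _)]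
  congr 1; funext x
  rw [mulLin_apply, mulLin_apply, inner_e₀, inner_e₁, zbarFun, smul_eq_mul]
  ring

theorem isMultiplier_zDist {θ : ℝ} (hθ : θ ≠ 0) : IsMultiplier θ zDist := by
  rw [zDist_eq]
  exact (multipliers θ).add_mem
    ((multipliers θ).smul_mem _ (isMultiplier_linDist hθ _))
    ((multipliers θ).smul_mem _ (isMultiplier_linDist hθ _))

theorem isMultiplier_zbarDist {θ : ℝ} (hθ : θ ≠ 0) : IsMultiplier θ zbarDist := by
  rw [zbarDist_eq]
  exact (multipliers θ).add_mem
    ((multipliers θ).smul_mem _ (isMultiplier_linDist hθ _))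
    ((multipliers θ).smul_mem _ (isMultiplier_linDist hθ _))

theorem monomial_hasTemperateGrowth (j k : ℕ) :
    (fun x => zbarFun x ^ j * zFun x ^ k).HasTemperateGrowth := by
  have hpow {f : Plane → ℂ} (hf : f.HasTemperateGrowth) (n : ℕ) :
      (fun x => f x ^ n).HasTemperateGrowth := by
    induction n with
    | zero => simpa only [pow_zero] using Function.HasTemperateGrowth.const (1 : ℂ)
    | succ n ih => simp only [pow_succ]; exact ih.mul hf
  exact (hpow zbarFun_hasTemperateGrowth j).mul (hpow zFun_hasTemperateGrowth k)

/-- The Schwartz function `z̄ʲ zᵏ f₀₀`, with pointwise products. -/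
def gaussMonomial (θ : ℝ) (j k : ℕ) : 𝓢(Plane, ℂ) :=
  smulLeftCLM ℂ (fun x => zbarFun x ^ j * zFun x ^ k) (f00 θ)

theorem gaussMonomial_apply (θ : ℝ) (j k : ℕ) (x : Plane) :
    gaussMonomial θ j k x = zbarFun x ^ j * zFun x ^ k * f00 θ x := by
  rw [gaussMonomial, smulLeftCLM_apply_apply (monomial_hasTemperateGrowth j k), smul_eq_mul]

theorem gaussMonomial_zero (θ : ℝ) : gaussMonomial θ 0 0 = f00 θ := by
  ext x; simp [gaussMonomial_apply]

theorem conj_zFun (x : Plane) : conj (zFun x) = zbarFun x := by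
  simp [zFun, zbarFun, sub_eq_add_neg]

theorem conjS_gaussMonomial {θ : ℝ} (hθ : 0 < θ) (j k : ℕ) :
    conjS (gaussMonomial θ j k) = gaussMonomial θ k j := by
  ext x
  rw [conjS_apply, gaussMonomial_apply, gaussMonomial_apply, map_mul, map_mul, map_pow, map_pow,
    conj_zFun, ← conj_zFun, Complex.conj_conj, ← conjS_apply, conjS_f00 hθ]
  ring

theorem zFun_add_smul (x v : Plane) (t : ℝ) : zFun (x + t • v) = zFun x + t * zFun v := by
  simp [zFun]; ring

theorem zbarFun_add_smul (x v : Plane) (t : ℝ) :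
    zbarFun (x + t • v) = zbarFun x + t * zbarFun v := by
  simp [zbarFun]; ring

theorem lineDeriv_gaussMonomial {θ : ℝ} (hθ : 0 < θ) (j k : ℕ) (v x : Plane) :
    (∂_{v} (gaussMonomial θ j k)) x =
      (j * zbarFun v) * gaussMonomial θ (j - 1) k x + (k * zFun v) * gaussMonomial θ j (k - 1) x
      - 2 / θ * (zbarFun v * gaussMonomial θ j (k + 1) x +
        zFun v * gaussMonomial θ (j + 1) k x) := by
  rw [lineDerivOp_apply, lineDeriv]
  have hA : HasDerivAt (fun t : ℝ => zbarFun x + t * zbarFun v) (zbarFun v) (0 : ℝ) := by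
    simpa using (((hasDerivAt_id (0 : ℝ)).ofReal_comp).mul_const (zbarFun v)).const_add (zbarFun x)
  have hB : HasDerivAt (fun t : ℝ => zFun x + t * zFun v) (zFun v) (0 : ℝ) := by
    simpa using (((hasDerivAt_id (0 : ℝ)).ofReal_comp).mul_const (zFun v)).const_add (zFun x)
  have hE := (((hA.mul hB).const_mul (-(2 / θ) : ℂ)).cexp).const_mul 2
  have h := ((hA.pow j).mul (hB.pow k)).mul hE
  have hfun : (fun t : ℝ => gaussMonomial θ j k (x + t • v)) = fun t : ℝ =>
      (zbarFun x + t * zbarFun v) ^ j * (zFun x + t * zFun v) ^ k * (2 * Complex.exp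
        (-(2 / θ) * ((zbarFun x + t * zbarFun v) * (zFun x + t * zFun v)))) := by
    funext t
    rw [gaussMonomial_apply, f00_apply hθ, zFun_add_smul, zbarFun_add_smul]
  rw [hfun]
  refine h.deriv.trans ?_
  simp only [gaussMonomial_apply, f00_apply hθ, Pi.mul_apply, Pi.pow_apply, Complex.ofReal_zero,
    zero_mul, add_zero]
  ring

theorem zFun_e₀ : zFun e₀ = (Real.sqrt 2 : ℂ)⁻¹ := by simp [zFun, e₀]
theorem zFun_e₁ : zFun e₁ = Complex.I / Real.sqrt 2 := by simp [zFun, e₁]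
theorem zbarFun_e₀ : zbarFun e₀ = (Real.sqrt 2 : ℂ)⁻¹ := by simp [zbarFun, e₀]
theorem zbarFun_e₁ : zbarFun e₁ = -Complex.I / Real.sqrt 2 := by simp [zbarFun, e₁]

theorem lineDeriv_neg_left_apply (v : Plane) (f : 𝓢(Plane, ℂ)) (x : Plane) :
    (∂_{-v} f) x = -(∂_{v} f) x := by
  rw [lineDerivOp_apply_eq_fderiv, lineDerivOp_apply_eq_fderiv, map_neg]

theorem inv_sqrt_two_sq : (Real.sqrt 2 : ℂ)⁻¹ ^ 2 = 1 / 2 := by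
  rw [inv_pow, sq, sqrt_two_mul_self, one_div]

/-- Right multiplication with `z` is `b ↦ z b - (θ/2) ∂b/∂z̄`, in terms of pointwise products. -/
theorem rightMul_zDist_gaussMonomial {θ : ℝ} (hθ : 0 < θ) (j k : ℕ) :
    rightMul θ zDist (gaussMonomial θ j k) =
      (2 : ℂ) • gaussMonomial θ j (k + 1) - (θ / 2 * j : ℂ) • gaussMonomial θ (j - 1) k := by
  rw [zDist_eq, rightMul_eq (((isRightMul_linDist hθ.ne' _ _).smul _).add
    ((isRightMul_linDist hθ.ne' _ _).smul _))]
  ext x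
  have hθt : (θ : ℂ) * (θ : ℂ)⁻¹ = 1 := mul_inv_cancel₀ (by exact_mod_cast hθ.ne')
  have hr := inv_sqrt_two_sq
  have hz : gaussMonomial θ j (k + 1) x = (x 0 + Complex.I * x 1) / Real.sqrt 2 *
      gaussMonomial θ j k x := by
    simp only [gaussMonomial_apply, zFun]; ring
  have h0 := lineDeriv_gaussMonomial hθ j k e₀ x
  have h1 := lineDeriv_gaussMonomial hθ j k e₁ x
  rw [zFun_e₀, zbarFun_e₀] at h0
  rw [zFun_e₁, zbarFun_e₁] at h1
  simp only [add_apply, sub_apply, smul_apply, smul_eq_mul, mulLin_apply, rot_e₀, rot_e₁,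
    lineDeriv_neg_left_apply, inner_e₀, inner_e₁]
  simp only [div_eq_mul_inv] at *
  set r := (Real.sqrt 2 : ℂ)⁻¹
  set t := (θ : ℂ)⁻¹
  set N := gaussMonomial θ j k x
  set R := gaussMonomial θ j (k + 1) x
  set S := gaussMonomial θ (j + 1) k x
  set P := gaussMonomial θ (j - 1) k x
  set Q := gaussMonomial θ j (k - 1) x
  set D₀ := (∂_{e₀} (gaussMonomial θ j k)) x
  set D₁ := (∂_{e₁} (gaussMonomial θ j k)) x
  have hD : Complex.I * D₁ + D₀ = 2 * r * (j * P) - 4 * r * t * R := by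
    rw [h0, h1]
    linear_combination (-j * r * P + k * r * Q + 2 * t * r * R - 2 * t * r * S) * Complex.I_sq
  linear_combination -hz - θ / 2 * r * hD + θ / 2 * r * D₀ * Complex.I_sq - θ * j * P * hr +
    2 * R * (r ^ 2 * hθt + hr)

/-- Left multiplication with `z̄` is `b ↦ z̄ b - (θ/2) ∂b/∂z`; on `z̄ʲ f₀₀` only the Gaussian depends
on `z`. -/
theorem leftMul_zbarDist_gaussMonomial {θ : ℝ} (hθ : 0 < θ) (j : ℕ) :
    leftMul θ zbarDist (gaussMonomial θ j 0) = (2 : ℂ) • gaussMonomial θ (j + 1) 0 := by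
  rw [zbarDist_eq, leftMul_eq (((isLeftMul_linDist hθ.ne' _ _).smul _).add
    ((isLeftMul_linDist hθ.ne' _ _).smul _))]
  ext x
  have hθt : (θ : ℂ) * (θ : ℂ)⁻¹ = 1 := mul_inv_cancel₀ (by exact_mod_cast hθ.ne')
  have hr := inv_sqrt_two_sq
  have hz : gaussMonomial θ (j + 1) 0 x = (x 0 - Complex.I * x 1) / Real.sqrt 2 *
      gaussMonomial θ j 0 x := by
    simp only [gaussMonomial_apply, zbarFun]; ring
  have h0 := lineDeriv_gaussMonomial hθ j 0 e₀ x
  have h1 := lineDeriv_gaussMonomial hθ j 0 e₁ x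
  rw [zFun_e₀, zbarFun_e₀] at h0
  rw [zFun_e₁, zbarFun_e₁] at h1
  simp only [Nat.cast_zero, zero_mul, add_zero] at h0 h1
  simp only [add_apply, sub_apply, smul_apply, smul_eq_mul, mulLin_apply, rot_e₀, rot_e₁,
    lineDeriv_neg_left_apply, inner_e₀, inner_e₁]
  simp only [div_eq_mul_inv] at *
  set r := (Real.sqrt 2 : ℂ)⁻¹
  set t := (θ : ℂ)⁻¹
  set N := gaussMonomial θ j 0 x
  set R := gaussMonomial θ j (0 + 1) x
  set S := gaussMonomial θ (j + 1) 0 x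
  set P := gaussMonomial θ (j - 1) 0 x
  set D₀ := (∂_{e₀} (gaussMonomial θ j 0)) x
  set D₁ := (∂_{e₁} (gaussMonomial θ j 0)) x
  have hD : Complex.I * D₁ - D₀ = 4 * r * t * S := by
    rw [h0, h1]
    linear_combination (-j * r * P + 2 * t * r * R - 2 * t * r * S) * Complex.I_sq
  linear_combination -hz + θ / 2 * r * hD + θ / 2 * r * D₀ * Complex.I_sq +
    2 * S * (r ^ 2 * hθt + hr)

theorem iterate_leftMul_zbarDist {θ : ℝ} (hθ : 0 < θ) (m : ℕ) :
    (leftMul θ zbarDist)^[m] (f00 θ) = (2 : ℂ) ^ m • gaussMonomial θ m 0 := by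
  induction m with
  | zero => simp [gaussMonomial_zero]
  | succ m ih =>
    rw [Function.iterate_succ_apply', ih]
    have h := (leftMulLM hθ.ne' (isMultiplier_zbarDist hθ.ne')).map_smul ((2 : ℂ) ^ m)
      (gaussMonomial θ m 0)
    refine h.trans ?_
    change _ • leftMul θ zbarDist _ = _
    rw [leftMul_zbarDist_gaussMonomial hθ, smul_smul, pow_succ]

/-- The coefficient of `z̄ᵐ⁻ˡ zⁿ⁻ˡ f₀₀` in `z̄^{⋆m} ⋆ f₀₀ ⋆ z^{⋆n}`. -/
def basisCoeff (θ : ℝ) (m n l : ℕ) : ℂ :=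
  (-θ) ^ l * 2 ^ (m - l) * 2 ^ (n - l) * (m.descFactorial l * n.choose l : ℕ)

theorem basisCoeff_zero_succ (θ : ℝ) (m n : ℕ) :
    basisCoeff θ m (n + 1) 0 = 2 * basisCoeff θ m n 0 := by
  simp [basisCoeff]; ring

theorem basisCoeff_succ_succ (θ : ℝ) {m n l : ℕ} (hl : l ≤ n) :
    basisCoeff θ m (n + 1) (l + 1) =
      2 * basisCoeff θ m n (l + 1) - θ / 2 * (m - l : ℕ) * basisCoeff θ m n l := by
  have h1 : (m.descFactorial (l + 1) : ℂ) = (m - l : ℕ) * m.descFactorial l := by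
    rw [Nat.descFactorial_succ]; push_cast; ring
  have h2 : ((n + 1).choose (l + 1) : ℂ) = n.choose l + n.choose (l + 1) := by
    rw [Nat.choose_succ_succ]; push_cast; ring
  have h3 : (2 : ℂ) ^ (n - l) * n.choose (l + 1) = 2 * 2 ^ (n - (l + 1)) * n.choose (l + 1) := by
    rcases hl.lt_or_eq with h | rfl
    · rw [← pow_succ', show n - (l + 1) + 1 = n - l by omega]
    · simp
  have h4 : (2 : ℂ) ^ (m - l) * (m - l : ℕ) = 2 * 2 ^ (m - (l + 1)) * (m - l : ℕ) := by
    rcases lt_or_ge l m with h | h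
    · rw [← pow_succ', show m - (l + 1) + 1 = m - l by omega]
    · simp [Nat.sub_eq_zero_of_le h]
  simp only [basisCoeff, Nat.cast_mul, Nat.add_sub_add_right, h1, h2]
  linear_combination ((-θ : ℂ) ^ (l + 1) * 2 ^ (m - (l + 1)) * (m - l : ℕ) *
    m.descFactorial l) * h3 + (θ / 2 * (-θ : ℂ) ^ l * 2 ^ (n - l) * m.descFactorial l *
      n.choose l) * h4

theorem basisCoeff_eq_zero (θ : ℝ) {m n l : ℕ} (h : n < l ∨ m < l) : basisCoeff θ m n l = 0 := by
  rcases h with h | h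
  · simp [basisCoeff, Nat.choose_eq_zero_of_lt h]
  · simp [basisCoeff, Nat.descFactorial_eq_zero_iff_lt.2 h]

/-- The functions `z̄^{⋆m} ⋆ f₀₀ ⋆ z^{⋆n}` as Laguerre polynomials times the Gaussian. -/
theorem iterate_rightMul_iterate_leftMul {θ : ℝ} (hθ : 0 < θ) (m n : ℕ) :
    (rightMul θ zDist)^[n] ((leftMul θ zbarDist)^[m] (f00 θ)) =
      ∑ l ∈ Finset.range (n + 1), basisCoeff θ m n l • gaussMonomial θ (m - l) (n - l) := by
  induction n with
  | zero => simp [iterate_leftMul_zbarDist hθ, basisCoeff]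
  | succ n ih =>
    rw [Function.iterate_succ_apply', ih]
    refine (map_sum (rightMulLM (isMultiplier_zDist hθ.ne')) _ _).trans ?_
    have hstep (l : ℕ) : rightMulLM (isMultiplier_zDist hθ.ne')
        (basisCoeff θ m n l • gaussMonomial θ (m - l) (n - l)) =
        (2 * basisCoeff θ m n l) • gaussMonomial θ (m - l) (n - l + 1) -
          (θ / 2 * (m - l : ℕ) * basisCoeff θ m n l) • gaussMonomial θ (m - l - 1) (n - l) := by
      rw [map_smul]
      refine (congrArg _ (rightMul_zDist_gaussMonomial hθ _ _)).trans ?_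
      rw [smul_sub, smul_smul, smul_smul]
      congr 2 <;> ring
    simp_rw [hstep]
    rw [Finset.sum_sub_distrib, Finset.sum_range_succ' _ (n + 1)]
    have hfirst : ∑ l ∈ Finset.range (n + 1),
        (2 * basisCoeff θ m n l) • gaussMonomial θ (m - l) (n - l + 1) =
        ∑ l ∈ Finset.range (n + 1), (2 * basisCoeff θ m n (l + 1)) •
          gaussMonomial θ (m - (l + 1)) (n + 1 - (l + 1)) +
        (2 * basisCoeff θ m n 0) • gaussMonomial θ (m - 0) (n + 1 - 0) := by
      rw [← Finset.sum_range_succ' (fun l => (2 * basisCoeff θ m n l) •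
        gaussMonomial θ (m - l) (n + 1 - l)) (n + 1), Finset.sum_range_succ _ (n + 1),
        basisCoeff_eq_zero θ (Or.inl n.lt_succ_self), mul_zero, zero_smul, add_zero]
      refine Finset.sum_congr rfl fun l hl => ?_
      rw [Nat.sub_add_comm (Nat.lt_succ_iff.1 (Finset.mem_range.1 hl))]
    rw [hfirst, add_sub_right_comm, ← Finset.sum_sub_distrib, basisCoeff_zero_succ]
    congr 1
    refine Finset.sum_congr rfl fun l hl => ?_
    rw [basisCoeff_succ_succ θ (Nat.lt_succ_iff.1 (Finset.mem_range.1 hl)), sub_smul,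
      Nat.add_sub_add_right]
    rfl

/-! ### Coherent states as translated Gaussians -/

/-- Derivatives of `L · h`, for a linear function `L` of norm at most one. -/
theorem norm_iteratedFDeriv_linear_mul_le {L : Plane →L[ℝ] ℂ} (hL : ‖L‖ ≤ 1) {h : Plane → ℂ}
    (hh : ContDiff ℝ ∞ h) {n : ℕ} {x : Plane} {B : ℝ} (hB : 0 ≤ B)
    (hb : ∀ i ≤ n, ‖iteratedFDeriv ℝ i h x‖ ≤ B) :
    ∀ i ≤ n, ‖iteratedFDeriv ℝ i (fun y => L y * h y) x‖ ≤ 2 ^ n * (1 + ‖x‖) * B := by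
  intro i hi
  have hLr (r : ℕ) : ‖iteratedFDeriv ℝ r L x‖ ≤ 1 + ‖x‖ := by
    match r with
    | 0 =>
      rw [norm_iteratedFDeriv_zero]
      have := L.le_of_opNorm_le hL x
      linarith [norm_nonneg x]
    | 1 =>
      rw [norm_iteratedFDeriv_one, L.fderiv]
      linarith [norm_nonneg x]
    | r + 2 =>
      rw [← norm_iteratedFDeriv_fderiv, show fderiv ℝ L = fun _ => L from funext fun y => L.fderiv,
        iteratedFDeriv_const_of_ne (Nat.succ_ne_zero r)]
      simp; positivity
  have h1 := norm_iteratedFDeriv_mul_le (𝕜 := ℝ) (N := ∞) L.contDiff hh x (n := i)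
    (mod_cast le_top)
  refine h1.trans ?_
  calc _ ≤ ∑ r ∈ Finset.range (i + 1), (i.choose r : ℝ) * (1 + ‖x‖) * B := by
        refine Finset.sum_le_sum fun r _ => ?_
        gcongr
        · exact hLr r
        · exact hb _ (by omega)
    _ = 2 ^ i * (1 + ‖x‖) * B := by
        rw [← Finset.sum_mul, ← Finset.sum_mul]
        congr 2
        exact_mod_cast Nat.sum_range_choose i
    _ ≤ _ := by gcongr; norm_num

/-- The coordinate `z` as a continuous linear map. -/
def zCLM : Plane →L[ℝ] ℂ :=
  (Real.sqrt 2)⁻¹ • (Complex.ofRealCLM ∘L EuclideanSpace.proj 0 +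
    Complex.I • (Complex.ofRealCLM ∘L EuclideanSpace.proj 1))

theorem zCLM_apply (x : Plane) : zCLM x = zFun x := by
  simp [zCLM, zFun]; ring

/-- The coordinate `z̄` as a continuous linear map. -/
def zbarCLM : Plane →L[ℝ] ℂ := (Complex.conjCLE : ℂ →L[ℝ] ℂ) ∘L zCLM

theorem zbarCLM_apply (x : Plane) : zbarCLM x = zbarFun x := by
  rw [← conj_zFun, ← zCLM_apply]; rfl

theorem norm_zFun_le (x : Plane) : ‖zFun x‖ ≤ ‖x‖ := by
  have h : ‖zFun x‖ ^ 2 = ‖x‖ ^ 2 / 2 := by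
    rw [← Complex.normSq_eq_norm_sq, zFun, Complex.normSq_div, Complex.normSq_ofReal,
      Real.mul_self_sqrt (by norm_num), EuclideanSpace.norm_sq_eq, Fin.sum_univ_two,
      mul_comm, Complex.normSq_add_mul_I]
    simp
  refine abs_le_of_sq_le_sq' ?_ (norm_nonneg x) |>.2
  rw [h]; nlinarith [sq_nonneg ‖x‖]

theorem norm_zCLM_le : ‖zCLM‖ ≤ 1 :=
  ContinuousLinearMap.opNorm_le_bound _ zero_le_one fun x => by
    rw [zCLM_apply, one_mul]; exact norm_zFun_le x

theorem norm_zbarCLM_le : ‖zbarCLM‖ ≤ 1 :=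
  ContinuousLinearMap.opNorm_le_bound _ zero_le_one fun x => by
    rw [zbarCLM_apply, one_mul, ← conj_zFun, RCLike.norm_conj]; exact norm_zFun_le x

theorem norm_iteratedFDeriv_gaussMonomial_le {θ : ℝ} {n : ℕ} {x : Plane} {B : ℝ} (hB : 0 ≤ B)
    (hb : ∀ i ≤ n, ‖iteratedFDeriv ℝ i (f00 θ) x‖ ≤ B) (j k : ℕ) :
    ∀ i ≤ n, ‖iteratedFDeriv ℝ i (gaussMonomial θ j k) x‖ ≤
      (2 ^ n * (1 + ‖x‖)) ^ (j + k) * B := by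
  induction j with
  | zero =>
    induction k with
    | zero => simpa [gaussMonomial_zero] using hb
    | succ k ih =>
      have h : (gaussMonomial θ 0 (k + 1) : Plane → ℂ) =
          fun y => zCLM y * gaussMonomial θ 0 k y := by
        funext y; rw [gaussMonomial_apply, gaussMonomial_apply, zCLM_apply]; ring
      rw [h]
      intro i hi
      refine (norm_iteratedFDeriv_linear_mul_le norm_zCLM_le ((gaussMonomial θ 0 k).smooth ⊤)
        (by positivity) ih i hi).trans (le_of_eq ?_)
      rw [← add_assoc, pow_succ]; ring
  | succ j ih =>
    have h : (gaussMonomial θ (j + 1) k : Plane → ℂ) =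
        fun y => zbarCLM y * gaussMonomial θ j k y := by
      funext y; rw [gaussMonomial_apply, gaussMonomial_apply, zbarCLM_apply]; ring
    rw [h]
    intro i hi
    refine (norm_iteratedFDeriv_linear_mul_le norm_zbarCLM_le ((gaussMonomial θ j k).smooth ⊤)
      (by positivity) ih i hi).trans (le_of_eq ?_)
    rw [add_right_comm, pow_succ]; ring

theorem exists_norm_iteratedFDeriv_f00_le {θ : ℝ} (hθ : 0 < θ) (n : ℕ) :
    ∃ (m : ℕ) (C : ℝ), 0 ≤ C ∧ ∀ i ≤ n, ∀ x : Plane, ‖iteratedFDeriv ℝ i (f00 θ) x‖ ≤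
      C * (Real.exp (-θ⁻¹ * ‖x‖ ^ 2) * (1 + ‖x‖) ^ m) := by
  choose k C hC h using fun i => norm_iteratedFDeriv_cexp_le
    (Function.hasTemperateGrowth_norm_sq (H := Plane)) ((-θ⁻¹ : ℝ) : ℂ) i
  refine ⟨∑ i ∈ Finset.range (n + 1), k i, 2 * ∑ i ∈ Finset.range (n + 1), C i,
    mul_nonneg zero_le_two (Finset.sum_nonneg fun i _ => hC i), fun i hi x => ?_⟩
  have hmem : i ∈ Finset.range (n + 1) := by simpa [Nat.lt_succ_iff] using hi
  have hf : (f00 θ : Plane → ℂ) =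
      fun x => (2 : ℂ) • Complex.exp (((-θ⁻¹ : ℝ) : ℂ) * ((‖x‖ ^ 2 : ℝ) : ℂ)) := by
    funext x; rw [f00_apply_norm hθ, smul_eq_mul]; push_cast; rfl
  have hsm : ContDiff ℝ ∞ fun x : Plane =>
      Complex.exp (((-θ⁻¹ : ℝ) : ℂ) * ((‖x‖ ^ 2 : ℝ) : ℂ)) :=
    (gaussianSchwartz (E := Plane) θ⁻¹ (inv_pos.2 hθ)).smooth ⊤
  rw [hf, iteratedFDeriv_const_smul_apply' (hsm.contDiffAt.of_le (mod_cast le_top)), norm_smul]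
  have h1 := h i x
  rw [Complex.ofReal_re] at h1
  have h2 : C i ≤ ∑ i ∈ Finset.range (n + 1), C i :=
    Finset.single_le_sum (fun i _ => hC i) hmem
  have h3 : k i ≤ ∑ i ∈ Finset.range (n + 1), k i :=
    Finset.single_le_sum (fun i _ => Nat.zero_le _) hmem
  have h4 : (1 : ℝ) ≤ 1 + ‖x‖ := by linarith [norm_nonneg x]
  have h5 : 0 ≤ ∑ i ∈ Finset.range (n + 1), C i := (hC i).trans h2
  calc _ ≤ 2 * (C i * Real.exp (-θ⁻¹ * ‖x‖ ^ 2) * (1 + ‖x‖) ^ k i) := by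
        rw [Complex.norm_ofNat]; gcongr
    _ ≤ 2 * ((∑ i ∈ Finset.range (n + 1), C i) * Real.exp (-θ⁻¹ * ‖x‖ ^ 2) *
        (1 + ‖x‖) ^ (∑ i ∈ Finset.range (n + 1), k i)) := by
        gcongr
    _ = _ := by ring

theorem exists_exp_bound {c : ℝ} (hc : 0 < c) (m : ℕ) (A : ℝ) :
    ∃ C : ℝ, 0 ≤ C ∧ ∀ r : ℝ, 0 ≤ r →
      (1 + r) ^ m * Real.exp (A * (1 + r)) * Real.exp (-c * r ^ 2) ≤ C := by
  refine ⟨m.factorial * Real.exp ((A + 1) + (A + 1) ^ 2 / (4 * c)), by positivity,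
    fun r hr => ?_⟩
  have h1 : (1 + r) ^ m ≤ m.factorial * Real.exp (1 + r) := by
    have := Real.pow_div_factorial_le_exp (1 + r) (by positivity) m
    rwa [div_le_iff₀ (by positivity), mul_comm] at this
  calc _ ≤ m.factorial * Real.exp (1 + r) * Real.exp (A * (1 + r)) * Real.exp (-c * r ^ 2) := by
        gcongr
    _ = m.factorial * Real.exp ((1 + r) + A * (1 + r) + -c * r ^ 2) := by
        rw [Real.exp_add (1 + r + A * (1 + r)), Real.exp_add (1 + r)]; ring
    _ ≤ _ := by
        refine mul_le_mul_of_nonneg_left (Real.exp_le_exp.2 ?_) (by positivity)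
        have : (A + 1) * r - c * r ^ 2 ≤ (A + 1) ^ 2 / (4 * c) := by
          rw [le_div_iff₀ (by positivity)]
          nlinarith [sq_nonneg (2 * c * r - (A + 1))]
        linarith

/-- Each Schwartz seminorm of `z̄ʲ zᵏ f₀₀` is bounded by a multiple of `εʲ⁺ᵏ (j + k)!`, for all
`ε > 0`: the Gaussian absorbs the factor `exp (C ‖x‖)`, whatever the constant `C`. -/
theorem seminorm_gaussMonomial_le {θ : ℝ} (hθ : 0 < θ) (p n : ℕ) {ε : ℝ} (hε : 0 < ε) :
    ∃ C : ℝ, 0 ≤ C ∧ ∀ j k, SchwartzMap.seminorm ℝ p n (gaussMonomial θ j k) ≤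
      C * (ε ^ (j + k) * (j + k).factorial) := by
  obtain ⟨m, C₀, hC₀, h₀⟩ := exists_norm_iteratedFDeriv_f00_le hθ n
  obtain ⟨C, hC, h⟩ := exists_exp_bound (inv_pos.2 hθ) (p + m) (2 ^ n / ε)
  refine ⟨C₀ * C, by positivity, fun j k =>
    SchwartzMap.seminorm_le_bound ℝ p n _ (by positivity) fun x => ?_⟩
  have h1 := norm_iteratedFDeriv_gaussMonomial_le (by positivity)
    (fun i hi => h₀ i hi x) j k n le_rfl
  have h2 : (2 ^ n * (1 + ‖x‖)) ^ (j + k) ≤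
      ε ^ (j + k) * (j + k).factorial * Real.exp (2 ^ n / ε * (1 + ‖x‖)) := by
    have := Real.pow_div_factorial_le_exp (2 ^ n / ε * (1 + ‖x‖)) (by positivity) (j + k)
    rw [div_le_iff₀ (by positivity)] at this
    have h3 : 2 ^ n * (1 + ‖x‖) = ε * (2 ^ n / ε * (1 + ‖x‖)) := by field_simp
    rw [h3, mul_pow, mul_assoc, mul_comm ((j + k).factorial : ℝ)]
    gcongr
  calc _ ≤ (1 + ‖x‖) ^ p * ((ε ^ (j + k) * (j + k).factorial *
        Real.exp (2 ^ n / ε * (1 + ‖x‖))) *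
        (C₀ * (Real.exp (-θ⁻¹ * ‖x‖ ^ 2) * (1 + ‖x‖) ^ m))) := by
        gcongr
        · linarith
        · exact h1.trans (by gcongr)
    _ = C₀ * ((1 + ‖x‖) ^ (p + m) * Real.exp (2 ^ n / ε * (1 + ‖x‖)) *
        Real.exp (-θ⁻¹ * ‖x‖ ^ 2)) * (ε ^ (j + k) * (j + k).factorial) := by
        rw [pow_add]; ring
    _ ≤ _ := by
        gcongr
        exact h _ (norm_nonneg x)

/-- The terms of the expansion in powers of `z̄`, `z` of the Gaussian centred at the point with
coordinate `κ`, with an additional index for the expansion of its normalisation. -/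
def gaussTerm (θ : ℝ) (κ : ℂ) (q : (ℕ × ℕ) × ℕ) : 𝓢(Plane, ℂ) :=
  ((2 / θ * κ) ^ q.1.1 / q.1.1.factorial * ((2 / θ * conj κ) ^ q.1.2 / q.1.2.factorial) *
    ((-(κ * conj κ) / θ) ^ q.2 / q.2.factorial)) • gaussMonomial θ q.1.1 q.1.2

/-- The power series of the translated Gaussian converges absolutely in the Schwartz space. -/
theorem summable_seminorm_gaussTerm {θ : ℝ} (hθ : 0 < θ) (κ : ℂ) (p n : ℕ) :
    Summable fun q => SchwartzMap.seminorm ℝ p n (gaussTerm θ κ q) := by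
  set R : ℝ := 2 / θ * ‖κ‖ with hR
  have hR0 : 0 ≤ R := by positivity
  obtain ⟨C, hC, h⟩ := seminorm_gaussMonomial_le hθ p n
    -- with this `ε` and `(j + k)! ≤ 2 ^ (j + k) j! k!`, the terms decay at least as `2 ^ (-j - k)`
    (ε := (4 * (R + 1))⁻¹) (by positivity)
  have hgeo : Summable fun j : ℕ => (1 / 2 : ℝ) ^ j :=
    summable_geometric_of_lt_one (by norm_num) (by norm_num)
  have hs := ((hgeo.mul_of_nonneg hgeo (fun _ => by positivity) fun _ => by positivity).mul_of_nonneg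
    (Real.summable_pow_div_factorial (‖κ‖ * ‖κ‖ / θ)) (fun _ => by simp only [Pi.zero_apply]; positivity)
    fun _ => by simp only [Pi.zero_apply]; positivity).mul_left C
  refine Summable.of_nonneg_of_le (fun _ => apply_nonneg _ _) (fun q => ?_) hs
  obtain ⟨⟨j, k⟩, l⟩ := q
  have hsm : SchwartzMap.seminorm ℝ p n (gaussTerm θ κ ((j, k), l)) =
      (R ^ j / j.factorial * (R ^ k / k.factorial) * ((‖κ‖ * ‖κ‖ / θ) ^ l / l.factorial)) *
        SchwartzMap.seminorm ℝ p n (gaussMonomial θ j k) := by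
    change SchwartzMap.seminorm ℂ p n (gaussTerm θ κ ((j, k), l)) = _ *
      SchwartzMap.seminorm ℂ p n (gaussMonomial θ j k)
    rw [gaussTerm, map_smul_eq_mul]
    simp [hR, abs_of_pos hθ]
  rw [hsm]
  have h1 : ((j + k).factorial : ℝ) ≤ 2 ^ (j + k) * (j.factorial * k.factorial) := by
    have h2 : ((j + k).choose k : ℝ) ≤ 2 ^ (j + k) := by exact_mod_cast Nat.choose_le_two_pow _ _
    have h3 : ((j + k).factorial : ℝ) = (j + k).choose k * j.factorial * k.factorial := by
      exact_mod_cast (Nat.add_choose_mul_factorial_mul_factorial j k).symm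
    rw [h3, mul_assoc]
    gcongr
  have h4 : R * (4 * (R + 1))⁻¹ * 2 ≤ 1 / 2 := by
    have h5 : R * (4 * (R + 1))⁻¹ * 2 = 1 / 2 * (R / (R + 1)) := by field_simp; norm_num
    rw [h5]
    have h6 : R / (R + 1) ≤ 1 := (div_le_one (by positivity)).2 (by linarith)
    linarith
  calc _ ≤ (R ^ j / j.factorial * (R ^ k / k.factorial) * ((‖κ‖ * ‖κ‖ / θ) ^ l / l.factorial)) *
        (C * ((4 * (R + 1))⁻¹ ^ (j + k) * (2 ^ (j + k) * (j.factorial * k.factorial)))) := by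
        gcongr
        exact (h j k).trans (by gcongr)
    _ = C * ((R * (4 * (R + 1))⁻¹ * 2) ^ j * (R * (4 * (R + 1))⁻¹ * 2) ^ k *
        ((‖κ‖ * ‖κ‖ / θ) ^ l / l.factorial)) := by
        have hj : (j.factorial : ℝ) ≠ 0 := by positivity
        have hk : (k.factorial : ℝ) ≠ 0 := by positivity
        clear_value R
        generalize (4 * (R + 1))⁻¹ = T
        simp only [mul_pow, pow_add]
        field_simp
    _ ≤ _ := by
        gcongr

/-- The point of the plane with complex coordinate `z = κ`. -/
def point (κ : ℂ) : Plane := !₂[Real.sqrt 2 * κ.re, Real.sqrt 2 * κ.im]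

theorem zFun_point (κ : ℂ) : zFun (point κ) = κ := by
  have h := sqrt_two_ne_zero
  simp [zFun, point]
  field_simp
  rw [mul_comm, Complex.re_add_im]

/-- The Gaussian `f₀₀` centred at `x`. -/
def gaussAt (θ : ℝ) (x : Plane) : 𝓢(Plane, ℂ) := compSubConstCLM ℂ x (f00 θ)

theorem gaussAt_point_apply {θ : ℝ} (hθ : 0 < θ) (κ : ℂ) (x : Plane) :
    gaussAt θ (point κ) x =
      2 * Complex.exp (-(2 / θ) * ((zbarFun x - conj κ) * (zFun x - κ))) := by
  have h1 : zFun (x - point κ) = zFun x - κ := by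
    have := zFun_add_smul x (point κ) (-1)
    rw [zFun_point] at this
    simpa [← sub_eq_add_neg] using this
  rw [gaussAt, compSubConstCLM_apply, f00_apply hθ, ← conj_zFun (x - point κ), h1, map_sub,
    conj_zFun]

theorem hasSum_pow_div_factorial (w : ℂ) :
    HasSum (fun n : ℕ => w ^ n / n.factorial) (Complex.exp w) := by
  rw [Complex.exp_eq_exp_ℂ]; exact NormedSpace.expSeries_div_hasSum_exp w

theorem hasSum_mul_mul {f g h : ℕ → ℂ} {a b c : ℂ} (hf : HasSum f a) (hg : HasSum g b)
    (hh : HasSum h c) : HasSum (fun q : (ℕ × ℕ) × ℕ => f q.1.1 * g q.1.2 * h q.2) (a * b * c) := by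
  have hs2 : Summable fun q : ℕ × ℕ => f q.1 * g q.2 :=
    summable_mul_of_summable_norm hf.summable.norm hg.summable.norm
  have h2 : HasSum (fun q : ℕ × ℕ => f q.1 * g q.2) (a * b) := hf.mul hg hs2
  have hs3 : Summable fun q : (ℕ × ℕ) × ℕ => f q.1.1 * g q.1.2 * h q.2 :=
    summable_mul_of_summable_norm (f := fun q : ℕ × ℕ => f q.1 * g q.2)
      h2.summable.norm hh.summable.norm
  exact HasSum.mul (f := fun q : ℕ × ℕ => f q.1 * g q.2) h2 hh hs3

theorem hasSum_pow_div_factorial_mul (u v w : ℂ) :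
    HasSum (fun q : (ℕ × ℕ) × ℕ => u ^ q.1.1 / q.1.1.factorial * (v ^ q.1.2 / q.1.2.factorial) *
      (w ^ q.2 / q.2.factorial)) (Complex.exp (u + v + w)) := by
  have h := hasSum_mul_mul (hasSum_pow_div_factorial u) (hasSum_pow_div_factorial v)
    (hasSum_pow_div_factorial w)
  rwa [← Complex.exp_add, ← Complex.exp_add] at h

theorem hasSum_gaussTerm_apply {θ : ℝ} (hθ : 0 < θ) (κ : ℂ) (x : Plane) :
    HasSum (fun q => gaussTerm θ κ q x)
      (Complex.exp (κ * conj κ / θ) * gaussAt θ (point κ) x) := by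
  have h4 := (hasSum_pow_div_factorial_mul (2 / θ * κ * zbarFun x) (2 / θ * conj κ * zFun x)
    (-(κ * conj κ) / θ)).mul_right (f00 θ x)
  have hval : Complex.exp (2 / θ * κ * zbarFun x + 2 / θ * conj κ * zFun x +
      -(κ * conj κ) / θ) * f00 θ x =
      Complex.exp (κ * conj κ / θ) * gaussAt θ (point κ) x := by
    rw [gaussAt_point_apply hθ, f00_apply hθ, mul_left_comm,
      mul_left_comm _ (2 : ℂ), ← Complex.exp_add, ← Complex.exp_add]
    congr 2
    ring
  rw [hval] at h4
  have hfun : (fun q => gaussTerm θ κ q x) = fun q : (ℕ × ℕ) × ℕ =>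
      (2 / θ * κ * zbarFun x) ^ q.1.1 / q.1.1.factorial *
      ((2 / θ * conj κ * zFun x) ^ q.1.2 / q.1.2.factorial) *
      ((-(κ * conj κ) / θ) ^ q.2 / q.2.factorial) * f00 θ x := by
    funext q
    rw [gaussTerm, smul_apply, smul_eq_mul, gaussMonomial_apply, mul_pow _ (zbarFun x),
      mul_pow _ (zFun x)]
    ring
  rw [hfun]
  exact h4

theorem hasSum_dist_apply (a : 𝓢'(Plane, ℂ)) {ι : Type*} {u : ι → 𝓢(Plane, ℂ)} {f : 𝓢(Plane, ℂ)}
    (h : HasSum u f) : HasSum (fun i => a (u i)) (a f) :=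
  h.map (a : 𝓢(Plane, ℂ) →L[ℂ] ℂ) a.continuous

theorem hasSum_gaussTerm {θ : ℝ} (hθ : 0 < θ) (κ : ℂ) :
    HasSum (gaussTerm θ κ) (Complex.exp (κ * conj κ / θ) • gaussAt θ (point κ)) := by
  have hs : Summable (gaussTerm θ κ) :=
    summable_of_summable_seminorm fun p n => summable_seminorm_gaussTerm hθ κ p n
  obtain ⟨f, hf⟩ := hs
  have hfe : f = Complex.exp (κ * conj κ / θ) • gaussAt θ (point κ) := by
    ext x
    exact (hasSum_dist_apply (TemperedDistribution.delta x) hf).unique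
      (hasSum_gaussTerm_apply hθ κ x)
  rwa [← hfe]

theorem conjS_smul (c : ℂ) (f : 𝓢(Plane, ℂ)) : conjS (c • f) = conj c • conjS f := by
  ext x; simp [conjS_apply]

theorem conj_basisCoeff (θ : ℝ) (m n l : ℕ) : conj (basisCoeff θ m n l) = basisCoeff θ m n l := by
  simp only [basisCoeff, map_mul, map_pow, map_neg, Complex.conj_ofReal, map_ofNat, map_natCast]

/-- The terms of the series of a coherent state, expanded into monomials; `p.1` is the index of the
matrix basis. -/
def expandedTerm (θ : ℝ) (κ : ℂ) (a : 𝓢'(Plane, ℂ)) (p : (ℕ × ℕ) × ℕ) : ℂ :=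
  conj κ ^ p.1.1 * κ ^ p.1.2 / (θ ^ (p.1.1 + p.1.2) * p.1.1.factorial * p.1.2.factorial) *
    (basisCoeff θ p.1.1 p.1.2 p.2 * a (gaussMonomial θ (p.1.2 - p.2) (p.1.1 - p.2)))

/-- Up to a constant, the series of the coherent state has the terms of the power series of the
translated Gaussian: with `j = n - l` and `k = m - l`, all factorials cancel. -/
theorem expandedTerm_add {θ : ℝ} (hθ : 0 < θ) (κ : ℂ) (a : 𝓢'(Plane, ℂ)) (j k l : ℕ) :
    expandedTerm θ κ a ((k + l, j + l), l) = a (gaussTerm θ κ ((j, k), l)) := by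
  have h1 : (k.factorial : ℂ) * (k + l).descFactorial l = (k + l).factorial := by
    have := Nat.factorial_mul_descFactorial (Nat.le_add_left l k)
    rw [Nat.add_sub_cancel] at this
    exact_mod_cast this
  have h2 : ((j + l).choose l : ℂ) * j.factorial * l.factorial = (j + l).factorial := by
    exact_mod_cast Nat.add_choose_mul_factorial_mul_factorial j l
  have hθ' : (θ : ℂ) ≠ 0 := by exact_mod_cast hθ.ne'
  have hj : (j.factorial : ℂ) ≠ 0 := by exact_mod_cast j.factorial_ne_zero
  have hk : (k.factorial : ℂ) ≠ 0 := by exact_mod_cast k.factorial_ne_zero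
  have hl : (l.factorial : ℂ) ≠ 0 := by exact_mod_cast l.factorial_ne_zero
  have hd : ((k + l).descFactorial l : ℂ) ≠ 0 := fun h => by
    rw [h, mul_zero] at h1; exact (k + l).factorial_ne_zero (by exact_mod_cast h1.symm)
  have hc : ((j + l).choose l : ℂ) ≠ 0 := fun h => by
    rw [h, zero_mul, zero_mul] at h2; exact (j + l).factorial_ne_zero (by exact_mod_cast h2.symm)
  rw [gaussTerm, map_smul, expandedTerm, smul_eq_mul]
  simp only [Nat.add_sub_cancel, basisCoeff, Nat.cast_mul]
  rw [← h1, ← h2, ← mul_assoc]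
  congr 1
  generalize ((k + l).descFactorial l : ℂ) = d at *
  generalize ((j + l).choose l : ℂ) = c at *
  generalize (j.factorial : ℂ) = fj at *
  generalize (k.factorial : ℂ) = fk at *
  generalize (l.factorial : ℂ) = fl at *
  simp only [pow_add, mul_pow, div_pow, neg_pow (θ : ℂ), neg_pow (κ * _)]
  field_simp

theorem hasSum_expandedTerm {θ : ℝ} (hθ : 0 < θ) (κ : ℂ) (a : 𝓢'(Plane, ℂ)) :
    HasSum (expandedTerm θ κ a) (Complex.exp (κ * conj κ / θ) * a (gaussAt θ (point κ))) := by
  have h := hasSum_dist_apply a (hasSum_gaussTerm hθ κ)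
  rw [map_smul, smul_eq_mul] at h
  let e : (ℕ × ℕ) × ℕ → (ℕ × ℕ) × ℕ := fun q => ((q.1.2 + q.2, q.1.1 + q.2), q.2)
  have he : Function.Injective e := by
    rintro ⟨⟨j, k⟩, l⟩ ⟨⟨j', k'⟩, l'⟩ h
    simp only [e, Prod.mk.injEq] at h ⊢
    omega
  refine (he.hasSum_iff fun p hp => ?_).1 (h.congr_fun ?_)
  · obtain ⟨⟨m, n⟩, l⟩ := p
    have hlt : n < l ∨ m < l := by
      by_contra! hle
      exact hp ⟨((n - l, m - l), l), by simp [e, hle.1, hle.2]⟩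
    simp [expandedTerm, basisCoeff_eq_zero θ hlt]
  · rintro ⟨⟨j, k⟩, l⟩
    exact (expandedTerm_add hθ κ a j k l)

theorem coeff_eq {θ : ℝ} (hθ : 0 < θ) (a : 𝓢'(Plane, ℂ)) (m n : ℕ) :
    coeff θ a m n = ((2 * Real.pi * θ)⁻¹ : ℝ) *
      (((Real.sqrt (θ ^ (m + n) * m.factorial * n.factorial))⁻¹ : ℝ) *
      ∑ l ∈ Finset.range (n + 1), basisCoeff θ m n l * a (gaussMonomial θ (n - l) (m - l))) := by
  rw [coeff, matrixBasis, conjS_smul, Complex.conj_ofReal, map_smul, smul_eq_mul,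
    iterate_rightMul_iterate_leftMul hθ, map_sum, map_sum]
  congr 2
  refine Finset.sum_congr rfl fun l _ => ?_
  rw [conjS_smul, conj_basisCoeff, conjS_gaussMonomial hθ, map_smul, smul_eq_mul]

theorem conj_coherentVec_mul {θ : ℝ} (hθ : 0 < θ) (κ : ℂ) (m n : ℕ) :
    conj (coherentVec θ κ m) * coherentVec θ κ n *
      ((Real.sqrt (θ ^ (m + n) * m.factorial * n.factorial))⁻¹ : ℝ) =
      ((2 * Real.pi * θ)⁻¹ : ℝ) * Complex.exp (-(κ * conj κ / θ)) *
        (conj κ ^ m * κ ^ n / (θ ^ (m + n) * m.factorial * n.factorial)) := by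
  have h1 : Real.exp (-‖κ‖ ^ 2 / (2 * θ)) * Real.exp (-‖κ‖ ^ 2 / (2 * θ)) =
      Real.exp (-(‖κ‖ ^ 2 / θ)) := by
    rw [← Real.exp_add]; congr 1; field_simp; ring
  have h2 : Complex.exp (-(κ * conj κ / θ)) = (Real.exp (-(‖κ‖ ^ 2 / θ)) : ℝ) := by
    rw [Complex.mul_conj']; push_cast; rfl
  have h3 : Real.sqrt (2 * Real.pi * θ) * Real.sqrt (2 * Real.pi * θ) = 2 * Real.pi * θ :=
    Real.mul_self_sqrt (by positivity)
  have h4 : Real.sqrt (m.factorial * θ ^ m) * Real.sqrt (n.factorial * θ ^ n) *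
      Real.sqrt (θ ^ (m + n) * m.factorial * n.factorial) =
      θ ^ (m + n) * m.factorial * n.factorial := by
    rw [← Real.sqrt_mul (by positivity),
      show (m.factorial * θ ^ m : ℝ) * (n.factorial * θ ^ n) =
        θ ^ (m + n) * m.factorial * n.factorial by rw [pow_add]; ring]
    exact Real.mul_self_sqrt (by positivity)
  have h4' : (θ ^ (m + n) * m.factorial * n.factorial : ℂ) =
      ((Real.sqrt (m.factorial * θ ^ m) * Real.sqrt (n.factorial * θ ^ n) *
      Real.sqrt (θ ^ (m + n) * m.factorial * n.factorial) : ℝ) : ℂ) := by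
    rw [h4]; push_cast; rfl
  rw [h2, ← h1, ← h3, h4', coherentVec, coherentVec, map_mul, map_div₀, map_pow,
    Complex.conj_ofReal, Complex.conj_ofReal]
  push_cast
  simp only [div_eq_mul_inv, mul_inv]
  ring

/-- The double series of a coherent state converges absolutely on every tempered distribution. -/
theorem hasSum_stateTerm {θ : ℝ} (hθ : 0 < θ) (κ : ℂ) (a : 𝓢'(Plane, ℂ)) :
    HasSum (stateTerm θ (coherentVec θ κ) a)
      (((2 * Real.pi * θ)⁻¹ : ℝ) * (((2 * Real.pi * θ)⁻¹ : ℝ) * a (gaussAt θ (point κ)))) := by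
  have hin (p : ℕ × ℕ) : HasSum (fun l => expandedTerm θ κ a (p, l))
      (∑ l ∈ Finset.range (p.2 + 1), expandedTerm θ κ a (p, l)) := by
    refine hasSum_sum_of_ne_finset_zero fun l hl => ?_
    rw [expandedTerm, basisCoeff_eq_zero θ (Or.inl (by simpa using hl)), zero_mul, mul_zero]
  have h := ((hasSum_expandedTerm hθ κ a).prod_fiberwise hin).mul_left
    ((((2 * Real.pi * θ)⁻¹ : ℝ) : ℂ) * (((2 * Real.pi * θ)⁻¹ : ℝ) *
      Complex.exp (-(κ * conj κ / θ))))
  have hval : (((2 * Real.pi * θ)⁻¹ : ℝ) : ℂ) * (((2 * Real.pi * θ)⁻¹ : ℝ) *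
      Complex.exp (-(κ * conj κ / θ))) *
      (Complex.exp (κ * conj κ / θ) * a (gaussAt θ (point κ))) =
      ((2 * Real.pi * θ)⁻¹ : ℝ) * (((2 * Real.pi * θ)⁻¹ : ℝ) * a (gaussAt θ (point κ))) := by
    have : Complex.exp (-(κ * conj κ / θ)) * Complex.exp (κ * conj κ / θ) = 1 := by
      rw [← Complex.exp_add, neg_add_cancel, Complex.exp_zero]
    linear_combination ((((2 * Real.pi * θ)⁻¹ : ℝ) : ℂ) * ((2 * Real.pi * θ)⁻¹ : ℝ) *
      a (gaussAt θ (point κ))) * this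
  rw [hval] at h
  have hfun : stateTerm θ (coherentVec θ κ) a = fun p : ℕ × ℕ =>
      (((2 * Real.pi * θ)⁻¹ : ℝ) : ℂ) * (((2 * Real.pi * θ)⁻¹ : ℝ) *
      Complex.exp (-(κ * conj κ / θ))) *
      ∑ l ∈ Finset.range (p.2 + 1), expandedTerm θ κ a (p, l) := by
    funext p
    simp only [expandedTerm]
    rw [← Finset.mul_sum, stateTerm, coeff_eq hθ]
    linear_combination (((2 * Real.pi * θ)⁻¹ : ℝ) * ∑ l ∈ Finset.range (p.2 + 1),
      basisCoeff θ p.1 p.2 l * a (gaussMonomial θ (p.2 - l) (p.1 - l))) *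
      conj_coherentVec_mul hθ κ p.1 p.2
  rw [hfun]
  exact h

/-- The coherent state with parameter `κ` is evaluation against the Gaussian centred at `κ`, on all
tempered distributions. -/
theorem coherentState_eq {θ : ℝ} (hθ : 0 < θ) (κ : ℂ) (a : 𝓢'(Plane, ℂ)) :
    coherentState θ κ a = ((2 * Real.pi * θ)⁻¹ : ℝ) * a (gaussAt θ (point κ)) := by
  rw [coherentState, vectorState, (hasSum_stateTerm hθ κ a).tsum_eq, ← mul_assoc,
    ← Complex.ofReal_mul, mul_inv_cancel₀ (by positivity), Complex.ofReal_one, one_mul]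

/-- Coherent states are finite on all multipliers, so the multiplier algebra itself is the largest
admissible subalgebra. -/
theorem isGreatest_multipliers {θ : ℝ} (hθ : 0 < θ) :
    IsGreatest {B : Submodule ℂ 𝓢'(Plane, ℂ) | IsAdmissible θ B} (multipliers θ) :=
  ⟨⟨isStarSubalgebra_multipliers hθ.ne', fun a _ κ => (hasSum_stateTerm hθ κ a).summable⟩,
    fun _ hB _ ha => hB.isStarSubalgebra.multiplier _ ha⟩

/-! ### The causal cone -/

/-- The commutator `[∂_w, L(a)]` is left multiplication with `∂_w a`, and left multiplication with
`c` has the quadratic form `φ ↦ ⟨c, φ ⋆ φ*⟩`. -/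
theorem pair_commutator {θ : ℝ} (hθ : θ ≠ 0) {a : 𝓢'(Plane, ℂ)} (ha : IsMultiplier θ a)
    (w : Plane) (φ : 𝓢(Plane, ℂ)) :
    pair (∂_{w} (leftMul θ a φ) - leftMul θ a (∂_{w} φ)) (conjS φ) =
      -a (∂_{w} (moyal θ φ (conjS φ))) := by
  rw [pair_sub_left, pair_lineDeriv_left, ← leftMul_spec ha, ← leftMul_spec ha,
    lineDeriv_moyal hθ, map_add]
  ring

/-- Since `γ⁰γ⁰ = -1` and `γ⁰γ¹ = diag(1, -1)`, the operator `𝒥[D, π(a)] = γ⁰γ^μ [∂_μ, L(a)]` is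
diagonal, with the derivatives of `a` along the two light-like directions as entries. -/
theorem spinorInner_commutator {θ : ℝ} (hθ : θ ≠ 0) {a : 𝓢'(Plane, ℂ)} (ha : IsMultiplier θ a)
    (φ : Spinor) :
    spinorInner φ (fundSymm (dirac (rep θ a φ) - rep θ a (dirac φ))) =
      a (∂_{e₀ - e₁} (moyal θ (φ 0) (conjS (φ 0)))) +
      a (∂_{e₀ + e₁} (moyal θ (φ 1) (conjS (φ 1)))) := by
  have hpair (f g : 𝓢(Plane, ℂ)) : ∫ x, conj (f x) * g x = pair g (conjS f) := by
    simp only [pair, conjS_apply, mul_comm]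
  have hrep (f g : 𝓢(Plane, ℂ)) (c d : ℂ) :
      leftMul θ a (c • f + d • g) = c • leftMul θ a f + d • leftMul θ a g := by
    have := (leftMulLM hθ ha).map_add (c • f) (d • g)
    rwa [map_smul, map_smul] at this
  have hsub (f : 𝓢(Plane, ℂ)) : ∂_{e₀ - e₁} f = ∂_{e₀} f - ∂_{e₁} f := by
    ext x; simp only [sub_apply, lineDerivOp_apply_eq_fderiv, map_sub]
  have h0 : fundSymm (dirac (rep θ a φ) - rep θ a (dirac φ)) 0 =
      (-1 : ℂ) • (∂_{e₀} (leftMul θ a (φ 0)) - leftMul θ a (∂_{e₀} (φ 0))) +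
      (∂_{e₁} (leftMul θ a (φ 0)) - leftMul θ a (∂_{e₁} (φ 0))) := by
    have h1 : dirac φ 1 = (1 : ℂ) • ∂_{e₀} (φ 0) + (-1 : ℂ) • ∂_{e₁} (φ 0) := by
      simp [dirac, gamma, e₀, e₁]
    have h2 : dirac (rep θ a φ) 1 = ∂_{e₀} (leftMul θ a (φ 0)) - ∂_{e₁} (leftMul θ a (φ 0)) := by
      simp [dirac, gamma, rep, e₀, e₁, sub_eq_add_neg]
    have h3 : fundSymm (dirac (rep θ a φ) - rep θ a (dirac φ)) 0 =
        (-1 : ℂ) • (dirac (rep θ a φ) 1 - leftMul θ a (dirac φ 1)) := by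
      simp [fundSymm, gamma, rep]
    rw [h3, h2, h1, hrep]
    module
  have h1 : fundSymm (dirac (rep θ a φ) - rep θ a (dirac φ)) 1 =
      (-1 : ℂ) • (∂_{e₀} (leftMul θ a (φ 1)) - leftMul θ a (∂_{e₀} (φ 1))) +
      (-1 : ℂ) • (∂_{e₁} (leftMul θ a (φ 1)) - leftMul θ a (∂_{e₁} (φ 1))) := by
    have h1 : dirac φ 0 = (1 : ℂ) • ∂_{e₀} (φ 1) + (1 : ℂ) • ∂_{e₁} (φ 1) := by
      simp [dirac, gamma, e₀, e₁]
    have h2 : dirac (rep θ a φ) 0 = ∂_{e₀} (leftMul θ a (φ 1)) + ∂_{e₁} (leftMul θ a (φ 1)) := by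
      simp [dirac, gamma, rep, e₀, e₁]
    have h3 : fundSymm (dirac (rep θ a φ) - rep θ a (dirac φ)) 1 =
        (-1 : ℂ) • (dirac (rep θ a φ) 0 - leftMul θ a (dirac φ 0)) := by
      simp [fundSymm, gamma, rep]
    rw [h3, h2, h1, hrep]
    module
  rw [spinorInner, Fin.sum_univ_two, hpair, hpair, h0, h1, pair_add_left, pair_add_left,
    pair_smul_left, pair_smul_left, pair_smul_left, pair_commutator hθ ha, pair_commutator hθ ha,
    pair_commutator hθ ha, pair_commutator hθ ha, hsub, lineDerivOp_left_add, map_sub, map_add]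
  ring

/-- The cone condition, tested on spinors with one component. -/
theorem mem_causalCone_multipliers {θ : ℝ} (hθ : θ ≠ 0) {a : 𝓢'(Plane, ℂ)} :
    a ∈ causalCone θ (multipliers θ) ↔ IsMultiplier θ a ∧ adj a = a ∧ ∀ φ : 𝓢(Plane, ℂ),
      (a (∂_{e₀ - e₁} (moyal θ φ (conjS φ)))).re ≤ 0 ∧
      (a (∂_{e₀ + e₁} (moyal θ φ (conjS φ)))).re ≤ 0 := by
  have hzero : moyal θ 0 (conjS 0) = 0 := by
    simpa only [zero_smul] using moyal_smul_left hθ 0 0 (conjS 0)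
  have h0 : a 0 = 0 := map_zero a
  constructor
  · rintro ⟨ha, hadj, h⟩
    refine ⟨ha, hadj, fun φ => ⟨?_, ?_⟩⟩
    · have := h ![φ, 0]
      rw [spinorInner_commutator hθ ha] at this
      have hz (v : Plane) : (∂_{v} (0 : 𝓢(Plane, ℂ))) = 0 := lineDerivOp_zero v
      simpa [-map_zero, hzero, hz, h0] using this
    · have := h ![0, φ]
      rw [spinorInner_commutator hθ ha] at this
      have hz (v : Plane) : (∂_{v} (0 : 𝓢(Plane, ℂ))) = 0 := lineDerivOp_zero v
      simpa [-map_zero, hzero, hz, h0] using this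
  · rintro ⟨ha, hadj, h⟩
    refine ⟨ha, hadj, fun φ => ?_⟩
    rw [spinorInner_commutator hθ ha, Complex.add_re]
    exact add_nonpos (h _).1 (h _).2

theorem gaussAt_moyal_conjS {θ : ℝ} (hθ : 0 < θ) (x : Plane) :
    moyal θ (gaussAt θ x) (conjS (gaussAt θ x)) = gaussAt θ x := by
  have h : conjS (gaussAt θ x) = gaussAt θ x := by
    ext y
    rw [conjS_apply, gaussAt, compSubConstCLM_apply, ← conjS_apply, conjS_f00 hθ]
  rw [h, gaussAt, moyal_translate, moyal_f00_f00 hθ]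

/-- The Gaussians are of the form `φ ⋆ φ*`, so a functional whose derivative along `v` is nonpositive
on the squares `φ ⋆ φ*` increases when the Gaussian is moved along `v`. -/
theorem apply_gaussAt_mono {θ : ℝ} (hθ : 0 < θ) {a : 𝓢'(Plane, ℂ)} {v : Plane}
    (h : ∀ φ : 𝓢(Plane, ℂ), (a (∂_{v} (moyal θ φ (conjS φ)))).re ≤ 0) (x : Plane)
    {t : ℝ} (ht : 0 ≤ t) : (a (gaussAt θ x)).re ≤ (a (gaussAt θ (x + t • v))).re := by
  have htr (s : ℝ) : compSubConstCLM ℂ (s • v) (gaussAt θ x) = gaussAt θ (x + s • v) := by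
    ext y
    simp only [gaussAt, compSubConstCLM_apply]
    congr 1; abel
  have hd (s : ℝ) : HasDerivAt (fun s : ℝ => (a (gaussAt θ (x + s • v))).re)
      (-(a (∂_{v} (gaussAt θ (x + s • v)))).re) s := by
    have := Complex.reCLM.hasFDerivAt.comp_hasDerivAt s
      (hasDerivAt_apply_translate a (gaussAt θ x) v s)
    simp only [htr] at this
    exact this
  have hm : Monotone fun s : ℝ => (a (gaussAt θ (x + s • v))).re :=
    monotone_of_hasDerivAt_nonneg hd fun s => by
      have := h (gaussAt θ (x + s • v))
      rw [gaussAt_moyal_conjS hθ] at this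
      simpa using this
  simpa using hm ht

/-- Translating the Gaussian by `x` changes the value of the linear function `⟪w, ·⟫` by
`2πθ⟪w, x⟫`. -/
theorem linDist_gaussAt {θ : ℝ} (hθ : 0 < θ) (w x : Plane) :
    linDist w (gaussAt θ x) = linDist w (f00 θ) + ((2 * Real.pi * θ * ⟪w, x⟫ : ℝ) : ℂ) := by
  rw [linDist_apply, ← integral_add_right_eq_self _ x, linDist_apply]
  have h (y : Plane) : mulLin w (gaussAt θ x) (y + x) =
      mulLin w (f00 θ) y + (⟪w, x⟫ : ℝ) * f00 θ y := by
    rw [mulLin_apply, mulLin_apply, gaussAt, compSubConstCLM_apply, add_sub_cancel_right,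
      inner_add_right]
    push_cast; ring
  simp only [h]
  rw [integral_add (SchwartzMap.integrable _) ((SchwartzMap.integrable _).const_mul _),
    integral_const_mul, integral_f00 hθ]
  push_cast; ring

theorem linDist_lineDeriv (w v : Plane) (f : 𝓢(Plane, ℂ)) :
    linDist w (∂_{v} f) = -((⟪w, v⟫ : ℝ) : ℂ) * ∫ x, f x := by
  have hd (x : Plane) : HasFDerivAt (fun y : Plane => ((⟪w, y⟫ : ℝ) : ℂ))
      (Complex.ofRealCLM ∘L innerSL ℝ w) x := (Complex.ofRealCLM ∘L innerSL ℝ w).hasFDerivAt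
  have hfd (x : Plane) : fderiv ℝ (fun y : Plane => ((⟪w, y⟫ : ℝ) : ℂ)) x v = (⟪w, v⟫ : ℝ) := by
    rw [(hd x).fderiv]; rfl
  have h := integral_mul_fderiv_eq_neg_fderiv_mul_of_integrable (μ := volume)
    (f := fun y : Plane => ((⟪w, y⟫ : ℝ) : ℂ)) (g := f) (v := v)
    (by simpa only [hfd] using f.integrable.const_mul _)
    ((mulLin w (∂_{v} f)).integrable.congr (Filter.Eventually.of_forall fun x => by
      rw [mulLin_apply, lineDerivOp_apply_eq_fderiv]))
    ((mulLin w f).integrable.congr (Filter.Eventually.of_forall fun x => mulLin_apply w f x))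
    (fun x _ => (hd x).differentiableAt) (fun x _ => f.differentiableAt)
  simp only [hfd, integral_const_mul] at h
  rw [linDist_apply, neg_mul, ← h]
  simp only [mulLin_apply, lineDerivOp_apply_eq_fderiv]

/-- A linear function that is nondecreasing along the two future light-like directions belongs to
the causal cone. -/
theorem linDist_mem_causalCone {θ : ℝ} (hθ : θ ≠ 0) {w : Plane} (h₁ : 0 ≤ ⟪w, e₀ - e₁⟫)
    (h₂ : 0 ≤ ⟪w, e₀ + e₁⟫) : linDist w ∈ causalCone θ (multipliers θ) := by
  have key (φ : 𝓢(Plane, ℂ)) (v : Plane) (h : 0 ≤ ⟪w, v⟫) :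
      (linDist w (∂_{v} (moyal θ φ (conjS φ)))).re ≤ 0 := by
    have h1 : ∫ x, moyal θ φ (conjS φ) x = ((∫ x, ‖φ x‖ ^ 2 : ℝ) : ℂ) := by
      rw [integral_moyal hθ, ← pair_conjS_self]; rfl
    rw [linDist_lineDeriv, h1, ← Complex.ofReal_neg, ← Complex.ofReal_mul, Complex.ofReal_re]
    exact mul_nonpos_of_nonpos_of_nonneg (neg_nonpos.2 h)
      (integral_nonneg fun _ => by positivity)
  exact (mem_causalCone_multipliers hθ).2 ⟨isMultiplier_linDist hθ w, adj_linDist w,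
    fun φ => ⟨key φ _ h₁, key φ _ h₂⟩⟩

/-! ### The causal order of coherent states -/

/-- The causal order of coherent states is that of the points in Minkowski space. -/
theorem causalLE_coherentState_iff {θ : ℝ} (hθ : 0 < θ) (κ₁ κ₂ : ℂ) :
    CausalLE θ (multipliers θ) (coherentState θ κ₁) (coherentState θ κ₂) ↔
      |(κ₂ - κ₁).im| ≤ (κ₂ - κ₁).re := by
  have hc : (0 : ℝ) < (2 * Real.pi * θ)⁻¹ := by positivity
  have h2 : (0 : ℝ) < Real.sqrt 2 := by positivity
  have hiff (a : 𝓢'(Plane, ℂ)) : (coherentState θ κ₁ a).re ≤ (coherentState θ κ₂ a).re ↔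
      (a (gaussAt θ (point κ₁))).re ≤ (a (gaussAt θ (point κ₂))).re := by
    rw [coherentState_eq hθ, coherentState_eq hθ, Complex.re_ofReal_mul, Complex.re_ofReal_mul]
    exact mul_le_mul_iff_right₀ hc
  rw [abs_le, Complex.sub_re, Complex.sub_im]
  constructor
  · intro h
    -- the linear functions `x₀ + x₁` and `x₀ - x₁` are in the causal cone
    have key {w : Plane} (h₁ : 0 ≤ ⟪w, e₀ - e₁⟫) (h₂ : 0 ≤ ⟪w, e₀ + e₁⟫) :
        ⟪w, point κ₁⟫ ≤ ⟪w, point κ₂⟫ := by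
      have := (hiff _).1 (h _ (linDist_mem_causalCone hθ.ne' h₁ h₂))
      rw [linDist_gaussAt hθ, linDist_gaussAt hθ, Complex.add_re, Complex.add_re,
        Complex.ofReal_re, Complex.ofReal_re] at this
      have hp : 0 < 2 * Real.pi * θ := by positivity
      exact le_of_mul_le_mul_left (by linarith) hp
    have hp := key (w := e₀ + e₁)
      (by simp only [inner_add_left, inner_e₀, inner_e₁]; simp [e₀, e₁])
      (by simp only [inner_add_left, inner_e₀, inner_e₁]; simp [e₀, e₁])
    have hm := key (w := e₀ - e₁)
      (by simp only [inner_sub_left, inner_e₀, inner_e₁]; simp [e₀, e₁])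
      (by simp only [inner_sub_left, inner_e₀, inner_e₁]; simp [e₀, e₁])
    simp only [inner_add_left, inner_sub_left, inner_e₀, inner_e₁, point] at hp hm
    simp at hp hm
    constructor <;> nlinarith
  · rintro ⟨h, h'⟩ a ha
    obtain ⟨-, -, ha⟩ := (mem_causalCone_multipliers hθ.ne').1 ha
    rw [hiff]
    -- go from `κ₁` to `κ₂` along the two light-like directions
    have hpt : point κ₂ = point κ₁ +
        (Real.sqrt 2 / 2 * ((κ₂.re - κ₁.re) + (κ₂.im - κ₁.im))) • (e₀ + e₁) +
        (Real.sqrt 2 / 2 * ((κ₂.re - κ₁.re) - (κ₂.im - κ₁.im))) • (e₀ - e₁) := by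
      ext i
      fin_cases i <;> simp [point, e₀, e₁] <;> ring
    rw [hpt]
    exact (apply_gaussAt_mono hθ (fun φ => (ha φ).2) _
      (mul_nonneg (by positivity) (by linarith))).trans
      (apply_gaussAt_mono hθ (fun φ => (ha φ).1) _ (mul_nonneg (by positivity) (by linarith)))

theorem exists_eq_lam_iff (z : ℂ) :
    (∃ μ ν : ℝ, 0 ≤ μ ∧ 0 ≤ ν ∧ z = μ * lam + ν * conj lam) ↔ |z.im| ≤ z.re := by
  have h2 : (0 : ℝ) < Real.sqrt 2 := by positivity
  have hlam : lam = ((Real.sqrt 2)⁻¹ : ℝ) * (1 + Complex.I) := by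
    rw [lam, div_eq_inv_mul, Complex.ofReal_inv]
  have hre (μ ν : ℝ) : (μ * lam + ν * conj lam).re = (μ + ν) / Real.sqrt 2 := by
    rw [hlam]
    simp only [Complex.add_re, Complex.re_ofReal_mul, Complex.conj_re, Complex.one_re,
      Complex.I_re]
    ring
  have him (μ ν : ℝ) : (μ * lam + ν * conj lam).im = (μ - ν) / Real.sqrt 2 := by
    rw [hlam]
    simp only [Complex.add_im, Complex.im_ofReal_mul, Complex.conj_im, Complex.one_im,
      Complex.I_im]
    ring
  rw [abs_le]
  constructor
  · rintro ⟨μ, ν, hμ, hν, rfl⟩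
    rw [hre, him, ← neg_div]
    constructor <;> gcongr <;> linarith
  · rintro ⟨h, h'⟩
    have hs : Real.sqrt 2 ^ 2 = 2 := Real.sq_sqrt (by norm_num)
    refine ⟨Real.sqrt 2 / 2 * (z.re + z.im), Real.sqrt 2 / 2 * (z.re - z.im),
      mul_nonneg (by positivity) (by linarith), mul_nonneg (by positivity) (by linarith), ?_⟩
    apply Complex.ext
    · rw [hre]; field_simp; ring
    · rw [him]; field_simp; ring

theorem arg_mem_Icc_pi_div_four_iff (z : ℂ) :
    z.arg ∈ Set.Icc (-(Real.pi / 4)) (Real.pi / 4) ↔ |z.im| ≤ z.re := by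
  rcases eq_or_ne z 0 with rfl | hz
  · simpa using (by positivity : (0 : ℝ) ≤ Real.pi / 4)
  have hpi := Real.pi_pos
  have hn : 0 < ‖z‖ := norm_pos_iff.2 hz
  rw [Set.mem_Icc, ← abs_le]
  by_cases hre : 0 < z.re
  · have h := Complex.abs_arg_lt_pi_div_two_iff.2 (Or.inl hre)
    rw [abs_lt] at h
    have ht : Real.tan z.arg = z.im / z.re := Complex.tan_arg z
    have hq : |z.im| ≤ z.re ↔ |Real.tan z.arg| ≤ 1 := by
      rw [ht, abs_div, abs_of_pos hre, div_le_one hre]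
    rw [hq, abs_le, abs_le, ← Real.tan_pi_div_four, ← Real.tan_neg]
    have hmem : z.arg ∈ Set.Ioo (-(Real.pi / 2)) (Real.pi / 2) := h
    rw [Real.strictMonoOn_tan.le_iff_le ⟨by linarith, by linarith⟩ hmem,
      Real.strictMonoOn_tan.le_iff_le hmem ⟨by linarith, by linarith⟩]
  · -- both sides fail outside the open right half-plane, as `z ≠ 0`
    have h1 : ¬ |z.arg| ≤ Real.pi / 4 := fun h => by
      rcases Complex.abs_arg_lt_pi_div_two_iff.1 (h.trans_lt (by linarith)) with h | h
      · exact hre h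
      · exact hz h
    refine iff_of_false h1 fun h => hz ?_
    have := abs_nonneg z.im
    have h0 : z.re = 0 := by linarith
    exact Complex.ext h0 (abs_nonpos_iff.1 (by linarith))

end
end Moyal

theorem theorem3 (θ : ℝ) (hθ : 0 < θ) :
    ∃ A : Submodule ℂ 𝓢'(Moyal.Plane, ℂ),
      IsGreatest {B : Submodule ℂ 𝓢'(Moyal.Plane, ℂ) | Moyal.IsAdmissible θ B} A ∧
      ∀ κ₁ κ₂ : ℂ,
        (Moyal.CausalLE θ A (Moyal.coherentState θ κ₁) (Moyal.coherentState θ κ₂) ↔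
          ∃ μ ν : ℝ, 0 ≤ μ ∧ 0 ≤ ν ∧ κ₂ - κ₁ = μ * Moyal.lam + ν * conj Moyal.lam) ∧
        (Moyal.CausalLE θ A (Moyal.coherentState θ κ₁) (Moyal.coherentState θ κ₂) ↔
          (κ₂ - κ₁).arg ∈ Set.Icc (-(Real.pi / 4)) (Real.pi / 4)) := by
  refine ⟨Moyal.multipliers θ, Moyal.isGreatest_multipliers hθ, fun κ₁ κ₂ => ?_⟩
  rw [Moyal.causalLE_coherentState_iff hθ, Moyal.exists_eq_lam_iff,
    Moyal.arg_mem_Icc_pi_div_four_iff]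
  exact ⟨Iff.rfl, Iff.rfl⟩
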